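/- Let $(W,S)$ be a Coxeter group with $S$ finite, with length function $\ell$ and with $m_{ss'}$ the order of $ss'$. Let $V=\mathbb R^S$ with basis $(r_s)_{s\in S}$ (the simple roots), with the symmetric bilinear form $(r_s,r_{s'})=-\cos(\pi/m_{ss'})$ (and $=-1$ if $m_{ss'}=\infty$), and with the action of $W$ given by $s\,x=x-2(r_s,x)r_s$. The roots are the vectors $wr_s$ ($w\in W$, $s\in S$); a root is positive (negative) if all its coordinates are $\ge 0$ ($\le 0$). For $w\in W$ let $R(w)$ be the set of positive roots $r$ such that $w^{-1}r$ is a negative root. **Depth functions, recursively.** If $\ell(ws)>\ell(w)$ and $\lambda:R(w)\to\mathbb N_+$, define $\Phi(\lambda,s):R(ws)\to\mathbb N_+$ to agree with $\lambda$ on $R(w)$ and to take, at a root $r\in R(ws)\setminus R(w)$, the value $1+\max\{\lambda(r') : r'\in R(w),\ (r,r')>0\}$, or $1$ if there is no such $r'$. Let $C(e)$ consist of the empty function, and for $w\ne e$ let $C(w)$ be the set of all $\Phi(\lambda,s)$ with $s\in S$, $\ell(ws)<\ell(w)$ and $\lambda\in C(ws)$. **Word posets.** The commutation class of a word in $S$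 is the set of words obtained from it by repeatedly exchanging two adjacent letters that commute in $W$. A word poset is a finite poset $P$ with a map $\sigma:P\to S$ such that (a) $u,v$ are comparable whenever $\sigma(u),\sigma(v)$ are equal or do not commute, and (b) if $v$ covers $u$ then $\sigma(u),\sigma(v)$ are equal or do not commute; isomorphisms are the poset isomorphisms that preserve $\sigma$. For a word $\mathbf w=\mathbf w_1\cdots\mathbf w_k$, $P(\mathbf w)$ is the word poset on $\{1,\dots,k\}$ with labels $i\mapsto\mathbf w_i$, ordered by the transitive closure of the relation "$i\le j$, and $\mathbf w_i,\mathbf w_j$ are equal or do not commute". A word poset $P$ is a reduced word poset for $w$ if $P\cong P(\mathbf w)$ for some reduced word $\mathbf w$ of $w$; then $\phi_P:P\to V$ is the map that corresponds under such an isomorphism to $i\mapsto \mathbf w_1\cdots\mathbf w_{i-1}r_{\mathbf w_i}$. For $u\in P$ let $\mathrm{dp}(u)$ be the number of elements of a longest chain $u_1<u_2<\cdots<u$ in $P$ with top element $u$. **Corollary 1.** Let $w\in W$. 1. For each reduced word poset $P$ for $w$, the map $\phi_P$ does not depend on the choice of $\mathbf w$ and of the isomorphism $P\cong P(\mathbf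 w)$, and it is a bijection of $P$ onto $R(w)$. Hence the depth function $\lambda_P:R(w)\to\mathbb N_+$, $\lambda_P(r)=\mathrm{dp}(\phi_P^{-1}(r))$, is well defined. 2. For each reduced word poset $P$ for $w$, the set of words $\mathbf w$ with $P(\mathbf w)\cong P$ is a commutation class of reduced words of $w$, and there is a bijection from the set of commutation classes of reduced words of $w$ onto $C(w)$ that sends the class of each such $P$ to $\lambda_P$. 3. For reduced word posets $P,P'$ for $w$, $\lambda_P=\lambda_{P'}$ if and only if $P\cong P'$. In particular, non-isomorphic reduced word posets for $w$ give distinct depth functions. -/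

import Mathlib

set_option linter.unusedSectionVars false

namespace CoxWord

/-! ### The geometric representation of a Coxeter group -/

section Representation

variable {B : Type*} [Fintype B] [DecidableEq B]

/-- The Gram matrix of the simple roots (in a `CoxeterMatrix`, the entry `0` stands for `∞`). -/
noncomputable def gram (M : CoxeterMatrix B) : Matrix B B ℝ :=
  fun s t => if M s t = 0 then -1 else -Real.cos (Real.pi / (M s t : ℝ))

/-- The bilinear form `(-,-)` on `V = ℝ^S`. -/
noncomputable def form (M : CoxeterMatrix B) : LinearMap.BilinForm ℝ (B → ℝ) :=
  Matrix.toBilin' (gram M)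

/-- The simple root `r_s`. -/
def simpleRoot (s : B) : B → ℝ := Pi.single s 1

theorem form_simpleRoot (M : CoxeterMatrix B) (s t : B) :
    form M (simpleRoot s) (simpleRoot t) = gram M s t := by
  simp [form, simpleRoot, Matrix.toBilin'_single]

theorem gram_self (M : CoxeterMatrix B) (s : B) : gram M s s = 1 := by
  simp [gram]

theorem gram_comm (M : CoxeterMatrix B) (s t : B) : gram M s t = gram M t s := by
  simp [gram, M.symmetric s t]

theorem two_form_self (M : CoxeterMatrix B) (s : B) :
    ((2 : ℝ) • form M (simpleRoot s)) (simpleRoot s) = 2 := by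
  simp [form_simpleRoot, gram_self]

/-- The action of a simple reflection on `V`: `x ↦ x - 2 (r_s, x) r_s`. -/
noncomputable def simpleAction (M : CoxeterMatrix B) (s : B) : (B → ℝ) ≃ₗ[ℝ] (B → ℝ) :=
  Module.reflection (x := simpleRoot s) (f := (2 : ℝ) • form M (simpleRoot s)) (two_form_self M s)

theorem simpleAction_apply (M : CoxeterMatrix B) (s : B) (x : B → ℝ) :
    simpleAction M s x = x - (2 * form M (simpleRoot s) x) • simpleRoot s := by
  simp [simpleAction, Module.reflection_apply]

theorem simpleAction_isLiftable (M : CoxeterMatrix B) : M.IsLiftable (simpleAction M) := by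
  intro s t
  by_cases hst : s = t
  · subst hst
    rw [M.diagonal, pow_one]
    ext1 x
    exact Module.involutive_reflection (two_form_self M s) x
  rcases Nat.eq_zero_or_pos (M s t) with h0 | hpos
  · rw [h0, pow_zero]
  have h1 : M s t ≠ 1 := M.off_diagonal s t hst
  by_cases h2 : M s t = 2
  · have hg : gram M s t = 0 := by simp [gram, h2]
    have hg' : gram M t s = 0 := by rw [gram_comm, hg]
    ext1 x
    rw [h2, pow_two]
    simp only [LinearEquiv.mul_apply, simpleAction_apply, map_sub, map_smul, form_simpleRoot,
      gram_self, hg, hg', LinearEquiv.coe_one, id]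
    module
  · have h3 : 3 ≤ M s t := by omega
    generalize hm : M s t = m at *
    have hm0 : (0 : ℝ) < m := by exact_mod_cast hpos
    have hm3 : (3 : ℝ) ≤ m := by exact_mod_cast h3
    set φ : ℝ := 2 * Real.pi / m with hφ
    have hsin : Real.sin φ ≠ 0 := by
      apply ne_of_gt
      apply Real.sin_pos_of_pos_of_lt_pi
      · positivity
      · rw [hφ, div_lt_iff₀ hm0]
        nlinarith [Real.pi_pos]
    have hS : ∀ k : ℤ, (Polynomial.Chebyshev.S ℝ k).eval (2 * Real.cos φ) * Real.sin φ
        = Real.sin ((k + 1) * φ) := by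
      intro k
      rw [← Polynomial.Chebyshev.U_real_cos, ← Polynomial.Chebyshev.S_comp_two_mul_X]
      simp
    have hgr : gram M s t = -Real.cos (Real.pi / m) := by
      simp only [gram, hm]
      rw [if_neg (by omega)]
    have ht : 2 * Real.cos φ =
        ((2 : ℝ) • form M (simpleRoot s)) (simpleRoot t) *
          ((2 : ℝ) • form M (simpleRoot t)) (simpleRoot s) - 2 := by
      simp only [LinearMap.smul_apply, form_simpleRoot, gram_comm M t s, hgr, smul_eq_mul]
      have : φ = 2 * (Real.pi / m) := by rw [hφ]; ring
      rw [this, Real.cos_two_mul]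
      ring
    have hmφ : (m : ℝ) * φ = 2 * Real.pi := by rw [hφ]; field_simp
    have key : ∀ a b : ℤ, Real.sin ((a + 1) * φ) + Real.sin ((b + 1) * φ) = 0 →
        (Polynomial.Chebyshev.S ℝ a).eval (2 * Real.cos φ) +
          (Polynomial.Chebyshev.S ℝ b).eval (2 * Real.cos φ) = 0 := by
      intro a b hab
      rw [← hS, ← hS, ← add_mul] at hab
      exact (mul_eq_zero.mp hab).resolve_right hsin
    ext1 z
    have hmain := Module.reflection_mul_reflection_pow_apply (two_form_self M s)
      (two_form_self M t) m z (2 * Real.cos φ) ht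
    change ((simpleAction M s * simpleAction M t) ^ m) z = z
    unfold simpleAction
    rw [hmain]
    rcases Nat.even_or_odd' m with ⟨k, hk | hk⟩
    · have e1 : ((m : ℤ) - 2) / 2 = k - 1 := by omega
      have e2 : ((m : ℤ) - 1) / 2 = k - 1 := by omega
      have hz : (Polynomial.Chebyshev.S ℝ ((k : ℤ) - 1)).eval (2 * Real.cos φ) = 0 := by
        have := hS ((k : ℤ) - 1)
        have hkφ : (k : ℝ) * φ = Real.pi := by
          have : (m : ℝ) = 2 * k := by exact_mod_cast hk
          rw [this] at hmφ
          linarith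
        push_cast at this
        rw [sub_add_cancel, hkφ, Real.sin_pi] at this
        exact (mul_eq_zero.mp this).resolve_right hsin
      rw [e1, e2, hz]
      simp
    · have e1 : ((m : ℤ) - 1) / 2 = k := by omega
      have e2 : ((m : ℤ) - 3) / 2 = k - 1 := by omega
      have e3 : (m : ℤ) / 2 = k := by omega
      have e4 : ((m : ℤ) - 2) / 2 = k - 1 := by omega
      have hz := key (k : ℤ) ((k : ℤ) - 1) (by
        push_cast
        have hk' : (m : ℝ) = 2 * k + 1 := by exact_mod_cast hk
        rw [hk'] at hmφ
        have : ((k : ℝ) + 1) * φ = 2 * Real.pi - k * φ := by linarith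
        rw [this, Real.sin_two_pi_sub, sub_add_cancel]
        ring)
      rw [e1, e2, e3, e4, hz]
      simp

variable {W : Type*} [Group W] {M : CoxeterMatrix B}

/-- The action of `W` on `V`. -/
noncomputable def action (cs : CoxeterSystem M W) : W →* ((B → ℝ) ≃ₗ[ℝ] (B → ℝ)) :=
  cs.lift ⟨simpleAction M, simpleAction_isLiftable M⟩

/-- The root system. -/
def roots (cs : CoxeterSystem M W) : Set (B → ℝ) :=
  {r | ∃ (w : W) (s : B), r = action cs w (simpleRoot s)}

/-- The positive roots. -/
def posRoots (cs : CoxeterSystem M W) : Set (B → ℝ) :=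
  {r | r ∈ roots cs ∧ ∀ s, 0 ≤ r s}

/-- The negative roots. -/
def negRoots (cs : CoxeterSystem M W) : Set (B → ℝ) :=
  {r | r ∈ roots cs ∧ ∀ s, r s ≤ 0}

/-- `R(w)`: the set of inversions of `w⁻¹`. -/
def R (cs : CoxeterSystem M W) (w : W) : Set (B → ℝ) :=
  {r | r ∈ posRoots cs ∧ action cs w⁻¹ r ∈ negRoots cs}

/-- `lam' = Φ(lam, s)` (meant for `s` not a right descent of `w`): `lam'` extends `lam`, and at a
root `r` of `R(ws)` outside `R(w)` it is one more than the largest value of `lam` at a root `r'` of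
`R(w)` with `(r, r') > 0`, and `1` if there is no such `r'`. -/
def IsPhi (cs : CoxeterSystem M W) (w : W) (s : B) (lam : R cs w → ℕ+)
    (lam' : R cs (w * cs.simple s) → ℕ+) : Prop :=
  ∀ r : R cs (w * cs.simple s),
    (∀ h : (r : B → ℝ) ∈ R cs w, lam' r = lam ⟨r, h⟩) ∧
    ((r : B → ℝ) ∉ R cs w →
      ((∀ r' : R cs w, ¬ 0 < form M r r') ∧ lam' r = 1) ∨
      ∃ r' : R cs w, 0 < form M r r' ∧
        (∀ r'' : R cs w, 0 < form M r r'' → lam r'' ≤ lam r') ∧ lam' r = lam r' + 1)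

/-- Membership in `C(w)`, recursively: the empty function is in `C(1)`, and if `s` is not a right
descent of `w` and `lam ∈ C(w)`, then `Φ(lam, s) ∈ C(ws)`. (The `s ∈ D_R(v)` are exactly those
for which `v = w s` with `s` not a right descent of `w`, where `w = v s`.) -/
inductive MemC (cs : CoxeterSystem M W) : (w : W) → (R cs w → ℕ+) → Prop
  | one (lam : R cs 1 → ℕ+) : MemC cs 1 lam
  | mul (w : W) (s : B) (lam : R cs w → ℕ+) (lam' : R cs (w * cs.simple s) → ℕ+) :
      ¬ cs.IsRightDescent w s → MemC cs w lam → IsPhi cs w s lam lam' →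
      MemC cs (w * cs.simple s) lam'

/-- The set `C(w)`. -/
def C (cs : CoxeterSystem M W) (w : W) : Set (R cs w → ℕ+) := {lam | MemC cs w lam}

/-- The root `𝐰₁ ⋯ 𝐰ᵢ₋₁ r_{𝐰ᵢ}` attached to a position of a word. -/
noncomputable def phiWord (cs : CoxeterSystem M W) (ω : List B) (i : Fin ω.length) : B → ℝ :=
  action cs (cs.wordProd (ω.take i)) (simpleRoot (ω.get i))

end Representation

/-! ### Words and word posets -/

section Words

variable {B : Type*} {W : Type*} [Group W] {M : CoxeterMatrix B}

/-- Two words differ by one application of a commutation relation. -/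
def CommStep (cs : CoxeterSystem M W) (ω ω' : List B) : Prop :=
  ∃ (l r : List B) (a b : B), Commute (cs.simple a) (cs.simple b) ∧
    ω = l ++ a :: b :: r ∧ ω' = l ++ b :: a :: r

/-- The commutation class of a word. -/
def commClass (cs : CoxeterSystem M W) (ω : List B) : Set (List B) :=
  {ω' | Relation.EqvGen (CommStep cs) ω ω'}

/-- The reduced words of `w`. -/
def reducedWords (cs : CoxeterSystem M W) (w : W) : Set (List B) :=
  {ω | cs.IsReduced ω ∧ cs.wordProd ω = w}

/-- The commutation classes of reduced words of `w`. -/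
def commClasses (cs : CoxeterSystem M W) (w : W) : Set (Set (List B)) :=
  {c | ∃ ω ∈ reducedWords cs w, c = commClass cs ω}

/-- Two symbols are equal or do not commute. -/
def Dep (cs : CoxeterSystem M W) (a b : B) : Prop :=
  a = b ∨ ¬ Commute (cs.simple a) (cs.simple b)

/-- A (finite) word poset. -/
structure WordPoset (cs : CoxeterSystem M W) where
  /-- the underlying set -/
  carrier : Type*
  [order : PartialOrder carrier]
  [finite : Finite carrier]
  /-- the labelling -/
  label : carrier → B
  comparable : ∀ u v, Dep cs (label u) (label v) → u ≤ v ∨ v ≤ u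
  dep_of_covBy : ∀ u v, u ⋖ v → Dep cs (label u) (label v)

attribute [instance] WordPoset.order WordPoset.finite

/-- Isomorphisms of word posets: label-preserving poset isomorphisms. -/
def WordPoset.Iso {cs : CoxeterSystem M W} (P P' : WordPoset cs) : Type _ :=
  {f : P.carrier ≃o P'.carrier // ∀ u, P'.label (f u) = P.label u}

/-- The relation `i → j` on the positions of a word. -/
def Arrow (cs : CoxeterSystem M W) (ω : List B) (i j : Fin ω.length) : Prop :=
  i ≤ j ∧ Dep cs (ω.get i) (ω.get j)

/-- The set of positions of a word. It is a type of its own because it does not carry the usual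
linear order. -/
structure Pos (cs : CoxeterSystem M W) (ω : List B) where
  /-- the index of the position -/
  idx : Fin ω.length

theorem le_of_transGen (cs : CoxeterSystem M W) (ω : List B) {i j : Fin ω.length}
    (h : Relation.TransGen (Arrow cs ω) i j) : i ≤ j := by
  induction h with
  | single h => exact h.1
  | tail _ h ih => exact ih.trans h.1

/-- The order `≤_𝐰`: the transitive closure of `→`. -/
instance (cs : CoxeterSystem M W) (ω : List B) : PartialOrder (Pos cs ω) where
  le i j := Relation.TransGen (Arrow cs ω) i.idx j.idx
  le_refl i := .single ⟨le_rfl, Or.inl rfl⟩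
  le_trans _ _ _ h h' := h.trans h'
  le_antisymm := by
    rintro ⟨i⟩ ⟨j⟩ h h'
    exact congrArg Pos.mk (le_antisymm (le_of_transGen cs ω h) (le_of_transGen cs ω h'))

instance (cs : CoxeterSystem M W) (ω : List B) : Finite (Pos cs ω) :=
  Finite.of_injective Pos.idx (by rintro ⟨i⟩ ⟨j⟩ h; exact congrArg Pos.mk h)

theorem dep_symm (cs : CoxeterSystem M W) {a b : B} (h : Dep cs a b) : Dep cs b a :=
  h.imp Eq.symm fun h h' => h h'.symm

theorem dep_of_pos_covBy (cs : CoxeterSystem M W) (ω : List B) (u v : Pos cs ω) (h : u ⋖ v) :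
    Dep cs (ω.get u.idx) (ω.get v.idx) := by
  have aux : ∀ i : Fin ω.length, Relation.TransGen (Arrow cs ω) i v.idx → Pos.mk i ⋖ v →
      Dep cs (ω.get i) (ω.get v.idx) := by
    intro i hi
    induction hi using Relation.TransGen.head_induction_on with
    | single h => intro _; exact h.2
    | head hab hbv ih =>
      rename_i a b
      intro hcov
      by_cases hne : a = b
      · subst hne; exact ih hcov
      · have hlt : (Pos.mk a : Pos cs ω) < Pos.mk b :=
          lt_of_le_of_ne (Relation.TransGen.single hab) (fun e => hne (congrArg Pos.idx e))
        have hbv' : (Pos.mk b : Pos cs ω) ≤ v := hbv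
        have hbe : (Pos.mk b : Pos cs ω) = v := by
          by_contra hb
          exact hcov.2 hlt (lt_of_le_of_ne hbv' hb)
        rw [← hbe]
        exact hab.2
  exact aux u.idx h.le h

/-- The word poset `P(𝐰)` of a word. -/
def ofWord (cs : CoxeterSystem M W) (ω : List B) : WordPoset cs where
  carrier := Pos cs ω
  label i := ω.get i.idx
  comparable u v h := by
    rcases le_total u.idx v.idx with h' | h'
    · exact Or.inl (Relation.TransGen.single ⟨h', h⟩)
    · exact Or.inr (Relation.TransGen.single ⟨h', dep_symm cs h⟩)
  dep_of_covBy := dep_of_pos_covBy cs ω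

/-- The words corresponding to a word poset `P`: those with `P(𝐰)` isomorphic to `P`. -/
def WordPoset.words {cs : CoxeterSystem M W} (P : WordPoset cs) : Set (List B) :=
  {ω | Nonempty (P.Iso (ofWord cs ω))}

/-- `P` is a reduced word poset for `w`: it corresponds to a reduced word of `w`. -/
def WordPoset.IsReducedFor {cs : CoxeterSystem M W} (P : WordPoset cs) (w : W) : Prop :=
  ∃ ω ∈ reducedWords cs w, ω ∈ P.words

/-- The number of elements of the longest chain `u₁ < u₂ < ⋯ < u` with top element `u`
(`Order.height` counts the strict inequalities). -/
noncomputable def dp {P : Type*} [PartialOrder P] (u : P) : ℕ+ :=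
  Nat.succPNat (Order.height u).toNat

end Words

section DepthFunctions

variable {B : Type*} [Fintype B] [DecidableEq B] {W : Type*} [Group W] {M : CoxeterMatrix B}
variable {cs : CoxeterSystem M W}

/-- The map `φ_P`, through a choice of a reduced word `𝐰` and an isomorphism `P ≅ P(𝐰)`. -/
noncomputable def WordPoset.phi {P : WordPoset cs} {w : W} (hP : P.IsReducedFor w)
    (u : P.carrier) : B → ℝ :=
  phiWord cs hP.choose ((Classical.choice hP.choose_spec.2).1 u).idx

open Classical in
/-- The depth function `λ_P(r) = dp(φ_P⁻¹(r))` (`φ_P` is a bijection onto `R(w)`; the value `1` at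
a root outside its image would be a dummy). -/
noncomputable def WordPoset.depthFun {P : WordPoset cs} {w : W} (hP : P.IsReducedFor w)
    (r : R cs w) : ℕ+ :=
  if h : ∃ u, WordPoset.phi hP u = r then dp h.choose else 1

end DepthFunctions

end CoxWord

/-! A word poset of a reduced word is visible on roots. For a reduced word of `w`, the roots
attached to its positions are distinct and form `R(w)`. This rests on the positivity theorem: `w r_s`
is positive if `ws` is longer than `w` (`action_simpleRoot_nonneg`, through a computation in dihedral
subgroups), so that `R(ws)` is `R(w)` with `w r_s` added (`R_mul_simple`, `bijOn_phiWord`).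

A commutation transposes two incomparable positions and keeps the attached roots
(`compatible_of_commStep`). Conversely, two words whose posets are isomorphic differ by
commutations: the letter that corresponds to the first letter of the other word can be moved to the
front, and so on (`eqvGen_of_orderIso`). The same argument works for an order isomorphism that
preserves the attached roots instead of the labels, as the root attached to a first position is
simple and determines its label. Since isomorphisms of word posets are unique, they all preserve the
attached roots (`phiWord_iso`), which makes `φ_P` well defined.

The form on `V` knows about the order: positions whose roots have a nonzero product are comparable
(`comparable_of_form_phiWord_ne_zero`), and the roots of a covering pair have a positive product
(`form_phiWord_pos_of_covBy`). Both come from following the root attached to a position `u` along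
the word: it stays supported on the labels of positions above `u`. This has two consequences.
The depth of a newly appended position is given by the rule `Φ` (`isPhi_of_isDepth`), so that `C(w)`
is the set of depth functions of reduced words. And a depth function determines the order on `R(w)`,
which is generated by the pairs of roots with a positive product, directed by increasing depth;
hence reduced words with the same depth function have posets that are isomorphic by a map preserving
the attached roots, and so are related by commutations (`eqvGen_of_isDepth`). -/

set_option linter.unusedSectionVars false

namespace CoxWord

/-! ### The form and the action on the space of roots -/

section Roots

variable {B : Type*} [Fintype B] [DecidableEq B] {W : Type*} [Group W] {M : CoxeterMatrix B}

theorem form_apply (M : CoxeterMatrix B) (x y : B → ℝ) :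
    form M x y = ∑ a, ∑ b, x a * gram M a b * y b := by
  simp [form, Matrix.toBilin'_apply]

theorem form_comm (M : CoxeterMatrix B) (x y : B → ℝ) : form M x y = form M y x := by
  rw [form_apply, form_apply, Finset.sum_comm]
  refine Finset.sum_congr rfl fun a _ => Finset.sum_congr rfl fun b _ => ?_
  rw [gram_comm M b a]
  ring

theorem form_simpleRoot_left (M : CoxeterMatrix B) (s : B) (y : B → ℝ) :
    form M (simpleRoot s) y = ∑ b, gram M s b * y b := by
  rw [form_apply, Finset.sum_eq_single s]
  · simp [simpleRoot]
  · intro a _ ha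
    simp [simpleRoot, ha]
  · simp

theorem simpleRoot_injective : Function.Injective (simpleRoot : B → B → ℝ) := by
  intro a b h
  by_contra hne
  have := congrFun h a
  simp [simpleRoot, hne] at this

theorem simpleAction_simpleRoot_self (M : CoxeterMatrix B) (s : B) :
    simpleAction M s (simpleRoot s) = -simpleRoot s := by
  rw [simpleAction_apply, form_simpleRoot, gram_self]
  module

theorem simpleAction_apply_of_ne (M : CoxeterMatrix B) {s t : B} (h : t ≠ s) (x : B → ℝ) :
    simpleAction M s x t = x t := by
  simp [simpleAction_apply, simpleRoot, h]

theorem form_simpleAction (M : CoxeterMatrix B) (s : B) (x y : B → ℝ) :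
    form M (simpleAction M s x) (simpleAction M s y) = form M x y := by
  simp only [simpleAction_apply, map_sub, map_smul, LinearMap.sub_apply, LinearMap.smul_apply,
    form_simpleRoot, gram_self, smul_eq_mul, form_comm M x (simpleRoot s)]
  ring

theorem action_simple (cs : CoxeterSystem M W) (s : B) :
    action cs (cs.simple s) = simpleAction M s :=
  cs.lift_apply_simple (simpleAction_isLiftable M) s

theorem action_mul_apply (cs : CoxeterSystem M W) (v w : W) (x : B → ℝ) :
    action cs (v * w) x = action cs v (action cs w x) := by
  rw [map_mul, LinearEquiv.mul_apply]

theorem action_inv_apply_self (cs : CoxeterSystem M W) (w : W) (x : B → ℝ) :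
    action cs w⁻¹ (action cs w x) = x := by
  rw [← action_mul_apply, inv_mul_cancel, map_one, LinearEquiv.coe_one, id]

theorem action_apply_inv_self (cs : CoxeterSystem M W) (w : W) (x : B → ℝ) :
    action cs w (action cs w⁻¹ x) = x := by
  rw [← action_mul_apply, mul_inv_cancel, map_one, LinearEquiv.coe_one, id]

theorem form_action (cs : CoxeterSystem M W) (w : W) (x y : B → ℝ) :
    form M (action cs w x) (action cs w y) = form M x y := by
  induction w using cs.simple_induction generalizing x y with
  | simple i => rw [action_simple, form_simpleAction]
  | one => simp
  | mul v w hv hw => rw [action_mul_apply, action_mul_apply, hv, hw]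

theorem form_self_of_mem_roots {cs : CoxeterSystem M W} {r : B → ℝ} (h : r ∈ roots cs) :
    form M r r = 1 := by
  obtain ⟨w, s, rfl⟩ := h
  rw [form_action, form_simpleRoot, gram_self]

theorem ne_zero_of_mem_roots {cs : CoxeterSystem M W} {r : B → ℝ} (h : r ∈ roots cs) :
    r ≠ 0 := by
  rintro rfl
  simpa using form_self_of_mem_roots h

theorem simpleRoot_mem_roots (cs : CoxeterSystem M W) (s : B) : simpleRoot s ∈ roots cs :=
  ⟨1, s, by simp⟩

theorem action_mem_roots {cs : CoxeterSystem M W} {r : B → ℝ} (h : r ∈ roots cs) (w : W) :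
    action cs w r ∈ roots cs := by
  obtain ⟨v, s, rfl⟩ := h
  exact ⟨w * v, s, by rw [action_mul_apply]⟩

theorem neg_mem_roots {cs : CoxeterSystem M W} {r : B → ℝ} (h : r ∈ roots cs) :
    -r ∈ roots cs := by
  obtain ⟨v, s, rfl⟩ := h
  exact ⟨v * cs.simple s, s, by
    rw [action_mul_apply, action_simple, simpleAction_simpleRoot_self, map_neg]⟩

/-! ### Commutation of simple reflections -/

theorem gram_nonpos (M : CoxeterMatrix B) {s t : B} (h : s ≠ t) : gram M s t ≤ 0 := by
  unfold gram
  split_ifs with h0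
  · norm_num
  · have h1 := M.off_diagonal s t h
    have h2 : (2 : ℝ) ≤ M s t := by exact_mod_cast (by omega : 2 ≤ M s t)
    have : 0 ≤ Real.cos (Real.pi / M s t) := by
      apply Real.cos_nonneg_of_neg_pi_div_two_le_of_le
      · have : 0 ≤ Real.pi / M s t := by positivity
        linarith [Real.pi_pos]
      · exact div_le_div_of_nonneg_left Real.pi_pos.le (by norm_num) h2
    linarith

theorem commute_iff_gram_eq_zero (cs : CoxeterSystem M W) {s t : B} (h : s ≠ t) :
    Commute (cs.simple s) (cs.simple t) ↔ gram M s t = 0 := by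
  constructor
  · intro hc
    -- compare the coefficients of `r_t` in `s t r_s = t s r_s`
    have h1 : action cs (cs.simple s * cs.simple t) (simpleRoot s) t =
        action cs (cs.simple t * cs.simple s) (simpleRoot s) t := by rw [hc.eq]
    rw [action_mul_apply, action_mul_apply, action_simple, action_simple,
      simpleAction_simpleRoot_self, simpleAction_apply_of_ne M h.symm, map_neg,
      simpleAction_apply, form_simpleRoot, gram_comm M t s] at h1
    simp [simpleRoot, h.symm] at h1
    linarith
  · intro hg
    have hM : M s t = 2 := by
      unfold gram at hg
      split_ifs at hg with h0
      · norm_num at hg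
      · by_contra h2
        have h1 := M.off_diagonal s t h
        have h3 : (3 : ℝ) ≤ M s t := by exact_mod_cast (by omega : 3 ≤ M s t)
        have : 0 < Real.cos (Real.pi / M s t) := by
          apply Real.cos_pos_of_mem_Ioo
          constructor
          · have : 0 ≤ Real.pi / M s t := by positivity
            linarith [Real.pi_pos]
          · have := div_le_div_of_nonneg_left Real.pi_pos.le (by norm_num) h3
            linarith [Real.pi_pos]
        linarith
    have hst := cs.simple_mul_simple_pow s t
    rw [hM, pow_two] at hst
    have := eq_inv_of_mul_eq_one_left hst
    rwa [mul_inv_rev, cs.inv_simple, cs.inv_simple] at this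

theorem dep_of_gram_ne_zero (cs : CoxeterSystem M W) {s t : B} (h : gram M s t ≠ 0) :
    Dep cs s t := by
  by_cases hst : s = t
  · exact Or.inl hst
  · exact Or.inr fun hc => h ((commute_iff_gram_eq_zero cs hst).1 hc)

theorem gram_eq_zero_of_not_dep (cs : CoxeterSystem M W) {s t : B} (h : ¬ Dep cs s t) :
    gram M s t = 0 :=
  not_not.1 fun hg => h (dep_of_gram_ne_zero cs hg)

theorem gram_neg_of_dep (cs : CoxeterSystem M W) {s t : B} (hne : s ≠ t) (h : Dep cs s t) :
    gram M s t < 0 :=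
  lt_of_le_of_ne (gram_nonpos M hne) fun hg =>
    (h.resolve_left hne) ((commute_iff_gram_eq_zero cs hne).2 hg)

theorem simpleAction_simpleRoot_of_not_dep (cs : CoxeterSystem M W) {s t : B}
    (h : ¬ Dep cs s t) : simpleAction M s (simpleRoot t) = simpleRoot t := by
  rw [simpleAction_apply, form_simpleRoot, gram_eq_zero_of_not_dep cs h]
  module

/-! ### Positivity of roots -/

/-- The sequence `sin (nθ) / sin θ` for `gram M s t = -cos θ` (and `n` if `gram M s t = -1`): the
coordinates of the roots of the dihedral group generated by `s` and `t`. -/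
noncomputable def dihedralCoeff (M : CoxeterMatrix B) (s t : B) : ℕ → ℝ
  | 0 => 0
  | 1 => 1
  | n + 2 => -2 * gram M s t * dihedralCoeff M s t (n + 1) - dihedralCoeff M s t n

theorem dihedralCoeff_nonneg (M : CoxeterMatrix B) {s t : B} (hst : s ≠ t) {n : ℕ}
    (hn : M s t ≠ 0 → n ≤ M s t) : 0 ≤ dihedralCoeff M s t n := by
  by_cases h0 : M s t = 0
  · have hg : gram M s t = -1 := by simp [gram, h0]
    have key : ∀ n : ℕ, dihedralCoeff M s t n = n ∧ dihedralCoeff M s t (n + 1) = n + 1 := by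
      intro n
      induction n with
      | zero => simp [dihedralCoeff]
      | succ n ih =>
        refine ⟨by exact_mod_cast ih.2, ?_⟩
        rw [dihedralCoeff, ih.1, ih.2, hg]
        push_cast
        ring
    rw [(key n).1]
    positivity
  · have hM : 2 ≤ M s t := by
      have := M.off_diagonal s t hst
      omega
    have hM' : (2 : ℝ) ≤ M s t := by exact_mod_cast hM
    have hg : gram M s t = -Real.cos (Real.pi / M s t) := by simp [gram, h0]
    set θ := Real.pi / M s t with hθ
    have hθpos : 0 < θ := by have := Real.pi_pos; positivity
    have hθM : (M s t : ℝ) * θ = Real.pi := by rw [hθ]; field_simp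
    have hsin : 0 < Real.sin θ := by
      apply Real.sin_pos_of_pos_of_lt_pi hθpos
      nlinarith
    have key : ∀ n : ℕ, dihedralCoeff M s t n * Real.sin θ = Real.sin (n * θ) ∧
        dihedralCoeff M s t (n + 1) * Real.sin θ = Real.sin ((n + 1) * θ) := by
      intro n
      induction n with
      | zero => simp [dihedralCoeff]
      | succ n ih =>
        refine ⟨by simpa using ih.2, ?_⟩
        have e1 : Real.sin (((n + 1 : ℕ) + 1 : ℝ) * θ) =
            2 * Real.cos θ * Real.sin ((n + 1) * θ) - Real.sin (n * θ) := by
          have h1 : ((n + 1 : ℕ) + 1 : ℝ) * θ = (n + 1) * θ + θ := by push_cast; ring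
          have h2 : (n : ℝ) * θ = (n + 1) * θ - θ := by ring
          rw [h1, h2, Real.sin_add, Real.sin_sub]
          ring
        rw [e1, dihedralCoeff, hg, ← ih.1, ← ih.2]
        ring
    have hs : 0 ≤ Real.sin (n * θ) := by
      apply Real.sin_nonneg_of_nonneg_of_le_pi (by positivity)
      rw [← hθM]
      have : (n : ℝ) ≤ M s t := by exact_mod_cast hn h0
      gcongr
    rw [← (key n).1] at hs
    exact nonneg_of_mul_nonneg_left hs hsin

theorem action_alternatingWord (cs : CoxeterSystem M W) (s t : B) (k : ℕ) :
    action cs (cs.wordProd (CoxeterSystem.alternatingWord s t k)) (simpleRoot s) =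
      dihedralCoeff M s t (k + 1) • simpleRoot (if Even k then s else t) +
      dihedralCoeff M s t k • simpleRoot (if Even k then t else s) := by
  induction k with
  | zero => simp [CoxeterSystem.alternatingWord, dihedralCoeff]
  | succ k ih =>
    rw [CoxeterSystem.alternatingWord_succ', cs.wordProd_cons, action_mul_apply, ih,
      action_simple, map_add, map_smul, map_smul, dihedralCoeff]
    have hg := gram_comm M t s
    by_cases hk : Even k <;>
    simp only [hk, Nat.even_add_one, not_true, not_false_eq_true, if_true, if_false,
      simpleAction_simpleRoot_self] <;>
    simp only [simpleAction_apply, form_simpleRoot, hg] <;>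
    module

/-- If `w s` is longer than `w`, then the root `w r_s` is positive. Write `w = v a` with `a` the
longest possible alternating word in `s` and a right descent `t` of `w`, ending in `t`, such that
`ℓ w = ℓ v + ℓ a`. Then neither `s` nor `t` is a right descent of `v`, so that `v r_s` and `v r_t`
are nonnegative by induction, and `a r_s` is a nonnegative combination of `r_s` and `r_t`. -/
theorem action_simpleRoot_nonneg (cs : CoxeterSystem M W) {w : W} {s : B}
    (h : ¬ cs.IsRightDescent w s) : 0 ≤ action cs w (simpleRoot s) := by
  induction hn : cs.length w using Nat.strong_induction_on generalizing w s with
  | _ n ih =>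
  subst hn
  by_cases hw : w = 1
  · subst hw
    simp [simpleRoot]
  obtain ⟨t, ht⟩ := cs.exists_rightDescent_of_ne_one hw
  have hst : s ≠ t := by rintro rfl; exact h ht
  let alt : ℕ → W := fun k => cs.wordProd (CoxeterSystem.alternatingWord s t k)
  have halt_len : ∀ k, cs.length (alt k) ≤ k := fun k => by
    simpa using cs.length_wordProd_le (CoxeterSystem.alternatingWord s t k)
  have halt_succ : ∀ k, alt (k + 1) = cs.simple (if Even k then t else s) * alt k := fun k => by
    simp only [alt, CoxeterSystem.alternatingWord_succ', cs.wordProd_cons]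
  let p : ℕ → Prop := fun k => ∃ v, w = v * alt k ∧ cs.length w = cs.length v + k
  classical
  have hp1 : p 1 := by
    refine ⟨w * cs.simple t, by simp [alt, CoxeterSystem.alternatingWord], ?_⟩
    exact (cs.isRightDescent_iff.1 ht).symm
  have hbound : ∀ k, p k → k ≤ cs.length w := by
    rintro k ⟨v, -, hv⟩
    omega
  have h1w := hbound 1 hp1
  set k := Nat.findGreatest p (cs.length w) with hk
  have hpk : p k := Nat.findGreatest_spec h1w hp1
  have hk1 : 1 ≤ k := Nat.le_findGreatest h1w hp1
  have hmax : ¬ p (k + 1) := fun hp => by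
    have := Nat.le_findGreatest (hbound _ hp) hp
    omega
  obtain ⟨v, hwv, hlen⟩ := hpk
  -- the letter that would prolong the alternating word is not a descent of `v`
  have hd1 : ¬ cs.IsRightDescent v (if Even k then t else s) := by
    intro hd
    apply hmax
    refine ⟨v * cs.simple (if Even k then t else s), ?_, ?_⟩
    · rw [halt_succ, mul_assoc, cs.simple_mul_simple_cancel_left, hwv]
    · have := cs.isRightDescent_iff.1 hd
      omega
  -- the first letter of the alternating word is not a descent of `v`: cancelling it against `v`
  -- would make `w` too short
  have hd2 : ¬ cs.IsRightDescent v (if Even k then s else t) := by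
    intro hd
    obtain ⟨j, hj⟩ : ∃ j, k = j + 1 := ⟨k - 1, by omega⟩
    have e : w = v * cs.simple (if Even k then s else t) * alt j := by
      have : (if Even k then s else t) = (if Even j then t else s) := by
        rw [hj]
        by_cases hj' : Even j <;> simp [hj', Nat.even_add_one]
      rw [this, mul_assoc, ← halt_succ, ← hj, hwv]
    have h1 := cs.length_mul_le (v * cs.simple (if Even k then s else t)) (alt j)
    rw [← e] at h1
    have h2 := halt_len j
    have h3 := cs.isRightDescent_iff.1 hd
    omega
  have hds : ¬ cs.IsRightDescent v s ∧ ¬ cs.IsRightDescent v t := by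
    by_cases hk' : Even k <;> simp only [hk', if_true, if_false] at hd1 hd2
    · exact ⟨hd2, hd1⟩
    · exact ⟨hd1, hd2⟩
  have hvs := ih (cs.length v) (by omega) hds.1 rfl
  have hvt := ih (cs.length v) (by omega) hds.2 rfl
  -- `a s` is reduced, too, which bounds its length by `M s t`
  have hkM : M s t ≠ 0 → k + 1 ≤ M s t := by
    intro h0
    by_contra hlt
    have hnr := cs.not_isReduced_alternatingWord t s (by rwa [M.symmetric])
      (by rw [M.symmetric]; omega : k + 1 > M t s)
    apply hnr
    have e : cs.wordProd (CoxeterSystem.alternatingWord t s (k + 1)) = alt k * cs.simple s := by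
      rw [CoxeterSystem.alternatingWord_succ, cs.wordProd_concat]
    have h1 := cs.length_mul_le v (alt k * cs.simple s)
    rw [← mul_assoc, ← hwv, cs.not_isRightDescent_iff.1 h, ← e] at h1
    have h2 := cs.length_wordProd_le (CoxeterSystem.alternatingWord t s (k + 1))
    unfold CoxeterSystem.IsReduced
    rw [CoxeterSystem.length_alternatingWord] at h2 ⊢
    omega
  have hc1 := dihedralCoeff_nonneg M hst hkM
  have hc0 := dihedralCoeff_nonneg M hst (n := k) (fun h0 => by have := hkM h0; omega)
  rw [hwv, action_mul_apply, action_alternatingWord, map_add, map_smul, map_smul]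
  by_cases hk' : Even k <;> simp only [hk', if_true, if_false]
  · exact add_nonneg (smul_nonneg hc1 hvs) (smul_nonneg hc0 hvt)
  · exact add_nonneg (smul_nonneg hc1 hvt) (smul_nonneg hc0 hvs)

theorem mem_posRoots_iff {cs : CoxeterSystem M W} {r : B → ℝ} :
    r ∈ posRoots cs ↔ r ∈ roots cs ∧ 0 ≤ r := Iff.rfl

theorem mem_negRoots_iff {cs : CoxeterSystem M W} {r : B → ℝ} :
    r ∈ negRoots cs ↔ r ∈ roots cs ∧ r ≤ 0 := Iff.rfl

theorem action_simpleRoot_mem_posRoots (cs : CoxeterSystem M W) {w : W} {s : B}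
    (h : ¬ cs.IsRightDescent w s) : action cs w (simpleRoot s) ∈ posRoots cs :=
  ⟨⟨w, s, rfl⟩, action_simpleRoot_nonneg cs h⟩

theorem neg_mem_negRoots {cs : CoxeterSystem M W} {r : B → ℝ} (h : r ∈ posRoots cs) :
    -r ∈ negRoots cs :=
  ⟨neg_mem_roots h.1, fun s => by simpa using h.2 s⟩

theorem neg_mem_posRoots {cs : CoxeterSystem M W} {r : B → ℝ} (h : r ∈ negRoots cs) :
    -r ∈ posRoots cs :=
  ⟨neg_mem_roots h.1, fun s => by simpa using h.2 s⟩

theorem not_mem_posRoots_of_mem_negRoots {cs : CoxeterSystem M W} {r : B → ℝ}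
    (h : r ∈ negRoots cs) : r ∉ posRoots cs := fun h' =>
  ne_zero_of_mem_roots h.1 (le_antisymm (mem_negRoots_iff.1 h).2 (mem_posRoots_iff.1 h').2)

theorem mem_posRoots_or_mem_negRoots {cs : CoxeterSystem M W} {r : B → ℝ} (h : r ∈ roots cs) :
    r ∈ posRoots cs ∨ r ∈ negRoots cs := by
  obtain ⟨w, s, rfl⟩ := h
  by_cases hd : cs.IsRightDescent w s
  · right
    have h1 := action_simpleRoot_mem_posRoots cs (cs.isRightDescent_iff_not_isRightDescent_mul.1 hd)
    have h2 := neg_mem_negRoots h1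
    rwa [action_mul_apply, action_simple, simpleAction_simpleRoot_self, map_neg, neg_neg] at h2
  · exact Or.inl (action_simpleRoot_mem_posRoots cs hd)

theorem simpleRoot_mem_posRoots (cs : CoxeterSystem M W) (s : B) :
    simpleRoot s ∈ posRoots cs :=
  ⟨simpleRoot_mem_roots cs s, fun t => by
    by_cases h : t = s <;> simp [simpleRoot, h]⟩

/-- A simple reflection makes only one positive root negative. -/
theorem eq_simpleRoot_of_simpleAction_mem_negRoots {cs : CoxeterSystem M W} {r : B → ℝ} {s : B}
    (hr : r ∈ posRoots cs) (hs : simpleAction M s r ∈ negRoots cs) : r = simpleRoot s := by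
  have h0 : ∀ t, t ≠ s → r t = 0 := fun t ht => by
    have h1 := hs.2 t
    rw [simpleAction_apply_of_ne M ht] at h1
    exact le_antisymm h1 (hr.2 t)
  have h1 : r = r s • simpleRoot s := by
    ext t
    by_cases ht : t = s
    · subst ht
      simp [simpleRoot]
    · simp [simpleRoot, ht, h0 t ht]
  have h2 := form_self_of_mem_roots hr.1
  rw [h1, map_smul, map_smul, LinearMap.smul_apply, form_simpleRoot, gram_self, smul_eq_mul,
    smul_eq_mul, mul_one] at h2
  have h3 := hr.2 s
  have h4 : r s = 1 := by nlinarith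
  rw [h1, h4, one_smul]

/-! ### The inversion sets -/

theorem R_one (cs : CoxeterSystem M W) : R cs 1 = ∅ := by
  ext r
  simp only [R, Set.mem_ofPred_eq, Set.mem_empty_iff_false, iff_false, not_and]
  intro h h'
  exact not_mem_posRoots_of_mem_negRoots (by simpa using h') h

theorem R_mul_simple (cs : CoxeterSystem M W) {w : W} {s : B} (h : ¬ cs.IsRightDescent w s) :
    R cs (w * cs.simple s) = insert (action cs w (simpleRoot s)) (R cs w) := by
  have hws := action_simpleRoot_mem_posRoots cs h
  ext r
  have e : action cs (w * cs.simple s)⁻¹ r = simpleAction M s (action cs w⁻¹ r) := by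
    rw [mul_inv_rev, cs.inv_simple, action_mul_apply, action_simple]
  simp only [R, Set.mem_ofPred_eq, Set.mem_insert_iff, e]
  constructor
  · rintro ⟨hr, hneg⟩
    rcases mem_posRoots_or_mem_negRoots (action_mem_roots hr.1 w⁻¹) with h1 | h1
    · left
      rw [← eq_simpleRoot_of_simpleAction_mem_negRoots h1 hneg, action_apply_inv_self]
    · exact Or.inr ⟨hr, h1⟩
  · rintro (rfl | ⟨hr, h1⟩)
    · refine ⟨hws, ?_⟩
      rw [action_inv_apply_self, simpleAction_simpleRoot_self]
      exact neg_mem_negRoots (simpleRoot_mem_posRoots cs s)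
    · refine ⟨hr, ?_⟩
      have h2 := action_mem_roots h1.1 (cs.simple s)
      rw [action_simple] at h2
      refine (mem_posRoots_or_mem_negRoots h2).resolve_left fun h3 => ?_
      have h4 := neg_mem_negRoots h3
      rw [← map_neg] at h4
      have h5 := eq_simpleRoot_of_simpleAction_mem_negRoots (neg_mem_posRoots h1) h4
      rw [← h5, map_neg, action_apply_inv_self] at hws
      exact not_mem_posRoots_of_mem_negRoots (neg_mem_negRoots hr) hws

theorem action_simpleRoot_notMem_R (cs : CoxeterSystem M W) (w : W) (s : B) :
    action cs w (simpleRoot s) ∉ R cs w := by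
  rintro ⟨-, h⟩
  rw [action_inv_apply_self] at h
  exact not_mem_posRoots_of_mem_negRoots h (simpleRoot_mem_posRoots cs s)

theorem isReduced_append_singleton_iff (cs : CoxeterSystem M W) (ω : List B) (s : B) :
    cs.IsReduced (ω ++ [s]) ↔ cs.IsReduced ω ∧ ¬ cs.IsRightDescent (cs.wordProd ω) s := by
  have e : cs.wordProd (ω ++ [s]) = cs.wordProd ω * cs.simple s := by
    rw [cs.wordProd_append, cs.wordProd_singleton]
  have h1 := cs.length_wordProd_le ω
  unfold CoxeterSystem.IsReduced
  rw [cs.not_isRightDescent_iff, e, List.length_append, List.length_singleton]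
  have h2 := cs.length_mul_le (cs.wordProd ω) (cs.simple s)
  rw [cs.length_simple] at h2
  omega

theorem phiWord_append_singleton (cs : CoxeterSystem M W) (ω : List B) (s : B)
    (i : Fin (ω ++ [s]).length) (h : i.val < ω.length) :
    phiWord cs (ω ++ [s]) i = phiWord cs ω ⟨i, h⟩ := by
  simp only [phiWord, List.get_eq_getElem]
  rw [List.take_append_of_le_length h.le, List.getElem_append_left h]

theorem phiWord_append_singleton_last (cs : CoxeterSystem M W) (ω : List B) (s : B)
    (i : Fin (ω ++ [s]).length) (h : i.val = ω.length) :
    phiWord cs (ω ++ [s]) i = action cs (cs.wordProd ω) (simpleRoot s) := by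
  obtain ⟨i, hi⟩ := i
  subst h
  simp [phiWord]

theorem bijOn_phiWord (cs : CoxeterSystem M W) {ω : List B} (hω : cs.IsReduced ω) :
    Set.BijOn (phiWord cs ω) Set.univ (R cs (cs.wordProd ω)) := by
  induction ω using List.reverseRecOn with
  | nil =>
    rw [cs.wordProd_nil, R_one]
    exact ⟨fun i => i.elim0, fun i => i.elim0, fun r hr => hr.elim⟩
  | append_singleton ω s ih =>
    obtain ⟨hr, hd⟩ := (isReduced_append_singleton_iff cs ω s).1 hω
    obtain ⟨hmaps, hinj, hsurj⟩ := ih hr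
    have hlen : (ω ++ [s]).length = ω.length + 1 := by simp
    rw [cs.wordProd_append, cs.wordProd_singleton, R_mul_simple cs hd]
    have hcase : ∀ i : Fin (ω ++ [s]).length, i.val < ω.length ∨ i.val = ω.length := fun i => by
      have := i.2
      omega
    have hnot := action_simpleRoot_notMem_R cs (cs.wordProd ω) s
    refine ⟨?_, ?_, ?_⟩
    · intro i _
      rcases hcase i with h | h
      · rw [phiWord_append_singleton cs ω s i h]
        exact Or.inr (hmaps trivial)
      · rw [phiWord_append_singleton_last cs ω s i h]
        exact Or.inl rfl
    · intro i _ j _ hij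
      rcases hcase i with h | h <;> rcases hcase j with h' | h'
      · rw [phiWord_append_singleton cs ω s i h, phiWord_append_singleton cs ω s j h'] at hij
        have := hinj trivial trivial hij
        exact Fin.ext (by simpa using this)
      · rw [phiWord_append_singleton cs ω s i h, phiWord_append_singleton_last cs ω s j h'] at hij
        exact absurd (hij ▸ hmaps trivial) hnot
      · rw [phiWord_append_singleton_last cs ω s i h, phiWord_append_singleton cs ω s j h'] at hij
        exact absurd (hij.symm ▸ hmaps trivial) hnot
      · exact Fin.ext (h.trans h'.symm)
    · rintro r (rfl | hr')
      · exact ⟨⟨ω.length, by omega⟩, trivial, phiWord_append_singleton_last cs ω s _ rfl⟩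
      · obtain ⟨i, -, rfl⟩ := hsurj hr'
        exact ⟨⟨i, by omega⟩, trivial, phiWord_append_singleton cs ω s _ i.2⟩

end Roots

/-! ### Isomorphisms of word posets and commutation classes -/

section WordPosets

variable {B : Type*} {W : Type*} [Group W] {M : CoxeterMatrix B} {cs : CoxeterSystem M W}

/-- The inverse of an isomorphism of word posets. -/
def WordPoset.Iso.symm {P P' : WordPoset cs} (f : P.Iso P') : P'.Iso P :=
  ⟨f.1.symm, fun u => by simpa using (f.2 (f.1.symm u)).symm⟩

/-- The composition of isomorphisms of word posets. -/
def WordPoset.Iso.trans {P P' P'' : WordPoset cs} (f : P.Iso P') (g : P'.Iso P'') : P.Iso P'' :=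
  ⟨f.1.trans g.1, fun u => (g.2 (f.1 u)).trans (f.2 u)⟩

/-- An automorphism of a finite poset fixes each element that is comparable to its image. -/
theorem orderIso_apply_eq_of_comparable {P : Type*} [PartialOrder P] [Finite P] (h : P ≃o P)
    {u : P} (hu : u ≤ h u ∨ h u ≤ u) : h u = u := by
  by_contra hne
  rcases hu with hu | hu
  · have := h.strictMono.strictMono_iterate_of_lt_map (lt_of_le_of_ne hu (Ne.symm hne))
    exact not_injective_infinite_finite _ this.injective
  · have := h.strictMono.strictAnti_iterate_of_map_lt (lt_of_le_of_ne hu hne)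
    exact not_injective_infinite_finite _ this.injective

/-- Elements with the same label are comparable, so an isomorphism of word posets is unique. -/
theorem WordPoset.Iso.apply_eq {P P' : WordPoset cs} (f g : P.Iso P') (u : P.carrier) :
    f.1 u = g.1 u := by
  have h1 := (f.trans g.symm).2 u
  have h2 := P.comparable u ((f.trans g.symm).1 u) (Or.inl h1.symm)
  have h3 := orderIso_apply_eq_of_comparable _ h2
  have h4 : g.1.symm (f.1 u) = u := h3
  rw [← h4, OrderIso.apply_symm_apply, h4]

theorem Pos.idx_le {ω : List B} {u v : Pos cs ω} (h : u ≤ v) : u.idx ≤ v.idx :=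
  le_of_transGen cs ω h

theorem Pos.le_of_arrow {ω : List B} {u v : Pos cs ω} (h : Arrow cs ω u.idx v.idx) : u ≤ v :=
  Relation.TransGen.single h

theorem Pos.idx_injective {ω : List B} : Function.Injective (Pos.idx : Pos cs ω → _) := by
  rintro ⟨i⟩ ⟨j⟩ h
  exact congrArg Pos.mk h

theorem Pos.idx_val_injective {ω : List B} {u v : Pos cs ω} (h : u.idx.val = v.idx.val) :
    u = v :=
  Pos.idx_injective (Fin.ext h)

/-- The order of the word poset of a factor of a word is induced by that of the word. -/
theorem transGen_arrow_factor {ω ω' : List B} (d : ℕ) (g : Fin ω.length → Fin ω'.length)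
    (hg : ∀ i, (g i).val = i.val + d) (hl : ∀ i, ω'.get (g i) = ω.get i) (i j : Fin ω.length) :
    Relation.TransGen (Arrow cs ω') (g i) (g j) ↔ Relation.TransGen (Arrow cs ω) i j := by
  have harrow : ∀ i j, Arrow cs ω' (g i) (g j) ↔ Arrow cs ω i j := fun i j => by
    simp only [Arrow, hl, Fin.le_def, hg, Nat.add_le_add_iff_right]
  constructor
  · intro h
    -- everything between `g i` and `g j` is in the image of `g`
    have key : ∀ k, Relation.TransGen (Arrow cs ω') (g i) k → k ≤ g j →
        ∃ k', k = g k' ∧ Relation.TransGen (Arrow cs ω) i k' := by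
      have hex : ∀ k, g i ≤ k → k ≤ g j → ∃ k', k = g k' := fun k h1 h2 => by
        have h1' := Fin.le_def.1 h1
        have h2' := Fin.le_def.1 h2
        rw [hg] at h1' h2'
        refine ⟨⟨k.val - d, by omega⟩, Fin.ext ?_⟩
        rw [hg]
        simp only
        omega
      intro k hk
      induction hk with
      | single h1 =>
        intro h2
        obtain ⟨k', rfl⟩ := hex _ h1.1 h2
        exact ⟨k', rfl, .single ((harrow _ _).1 h1)⟩
      | tail h1 h2 ih =>
        intro h3
        obtain ⟨b, rfl, hb⟩ := ih (h2.1.trans h3)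
        obtain ⟨k', rfl⟩ := hex _ ((le_of_transGen cs ω' h1).trans h2.1) h3
        exact ⟨k', rfl, hb.tail ((harrow _ _).1 h2)⟩
    obtain ⟨k', hk, hk'⟩ := key _ h le_rfl
    have : j = k' := by
      have := congrArg Fin.val hk
      rw [hg, hg] at this
      exact Fin.ext (by omega)
    rwa [this]
  · exact fun h => Relation.TransGen.lift g (fun a b hab => (harrow a b).2 hab) _ _ h

/-- A position of `τ`, as a position of `a :: τ`. -/
def Pos.cons (a : B) {τ : List B} (u : Pos cs τ) : Pos cs (a :: τ) := ⟨u.idx.succ⟩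

/-- The first position of `a :: τ`. -/
def Pos.head (a : B) (τ : List B) : Pos cs (a :: τ) := ⟨0, Nat.succ_pos _⟩

theorem Pos.cons_le_cons {a : B} {τ : List B} {u v : Pos cs τ} :
    Pos.cons a u ≤ Pos.cons a v ↔ u ≤ v :=
  transGen_arrow_factor (ω := τ) (ω' := a :: τ) 1 Fin.succ (fun _ => rfl) (fun _ => rfl) _ _

theorem Pos.cons_injective (a : B) {τ : List B} :
    Function.Injective (Pos.cons a : Pos cs τ → Pos cs (a :: τ)) := fun u v h => by
  have := congrArg (fun x => x.idx.val) h
  exact Pos.idx_val_injective (by simpa [Pos.cons] using this)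

theorem Pos.cons_ne_head {a : B} {τ : List B} (u : Pos cs τ) : Pos.cons a u ≠ Pos.head a τ :=
  fun h => by
    have := congrArg (fun x => x.idx.val) h
    simp [Pos.cons, Pos.head] at this

theorem Pos.exists_cons_eq {a : B} {τ : List B} {u : Pos cs (a :: τ)} (h : u ≠ Pos.head a τ) :
    ∃ v, Pos.cons a v = u := by
  have h0 : u.idx.val ≠ 0 := fun h0 => h (Pos.idx_val_injective h0)
  have h1 : u.idx.val < τ.length + 1 := u.idx.2
  refine ⟨⟨⟨u.idx.val - 1, by omega⟩⟩, Pos.idx_val_injective ?_⟩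
  simp only [Pos.cons, Fin.val_succ]
  omega

theorem Pos.eq_head_of_le_head {a : B} {τ : List B} {u : Pos cs (a :: τ)}
    (h : u ≤ Pos.head a τ) : u = Pos.head a τ :=
  Pos.idx_val_injective (Nat.le_zero.1 (Pos.idx_le h))

/-- An order isomorphism that matches the first positions restricts to the remaining ones. -/
theorem exists_orderIso_of_cons {a b : B} {σ τ : List B}
    (h : Pos cs (b :: σ) ≃o Pos cs (a :: τ)) (h0 : h (Pos.head b σ) = Pos.head a τ) :
    ∃ k : Pos cs σ ≃o Pos cs τ, ∀ u, h (Pos.cons b u) = Pos.cons a (k u) := by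
  have h1 : ∀ u : Pos cs σ, ∃ v, Pos.cons a v = h (Pos.cons b u) := fun u =>
    Pos.exists_cons_eq fun e => Pos.cons_ne_head u (h.injective (e.trans h0.symm))
  have h2 : ∀ v : Pos cs τ, ∃ u, Pos.cons b u = h.symm (Pos.cons a v) := fun v =>
    Pos.exists_cons_eq fun e => Pos.cons_ne_head v (by rw [← h0, ← e, h.apply_symm_apply])
  choose k hk using h1
  choose k' hk' using h2
  refine ⟨{ toFun := k, invFun := k', left_inv := fun u => ?_, right_inv := fun v => ?_,
            map_rel_iff' := ?_ }, fun u => (hk u).symm⟩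
  · apply Pos.cons_injective b
    rw [hk', hk, h.symm_apply_apply]
  · apply Pos.cons_injective a
    rw [hk, hk', h.apply_symm_apply]
  · intro u v
    change k u ≤ k v ↔ u ≤ v
    rw [← Pos.cons_le_cons (a := a), hk, hk, h.le_iff_le, Pos.cons_le_cons]

theorem commStep_cons {ω ω' : List B} (a : B) (h : CommStep cs ω ω') :
    CommStep cs (a :: ω) (a :: ω') := by
  obtain ⟨l, r, x, y, hxy, rfl, rfl⟩ := h
  exact ⟨a :: l, r, x, y, hxy, rfl, rfl⟩

theorem eqvGen_commStep_cons {ω ω' : List B} (a : B)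
    (h : Relation.EqvGen (CommStep cs) ω ω') :
    Relation.EqvGen (CommStep cs) (a :: ω) (a :: ω') := by
  induction h with
  | rel _ _ h => exact .rel _ _ (commStep_cons a h)
  | refl _ => exact .refl _
  | symm _ _ _ ih => exact .symm _ _ ih
  | trans _ _ _ _ _ ih ih' => exact .trans _ _ _ ih ih'

/-- A letter can be moved to the front past letters that commute with it. -/
theorem eqvGen_commStep_move_to_front (α β : List B) (b : B) (h : ∀ c ∈ α, ¬ Dep cs c b) :
    Relation.EqvGen (CommStep cs) (α ++ b :: β) (b :: (α ++ β)) := by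
  induction α with
  | nil => exact .refl _
  | cons c α ih =>
    refine .trans _ _ _ (eqvGen_commStep_cons c (ih fun x hx => h x (by simp [hx]))) ?_
    have hc : Commute (cs.simple c) (cs.simple b) :=
      not_not.1 fun hc => h c (by simp) (Or.inr hc)
    exact .rel _ _ ⟨[], α ++ β, c, b, hc, rfl, rfl⟩

end WordPosets

section Compatible

variable {B : Type*} [Fintype B] [DecidableEq B] {W : Type*} [Group W] {M : CoxeterMatrix B}
variable {cs : CoxeterSystem M W}

theorem phiWord_cons (a : B) (τ : List B) (u : Pos cs τ) :
    phiWord cs (a :: τ) (Pos.cons a u).idx = action cs (cs.simple a) (phiWord cs τ u.idx) := by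
  simp only [phiWord, Pos.cons, Fin.val_succ, List.take_succ_cons, cs.wordProd_cons,
    action_mul_apply]
  rfl

theorem phiWord_head (a : B) (τ : List B) :
    phiWord cs (a :: τ) (Pos.head (cs := cs) a τ).idx = simpleRoot a := by
  simp [phiWord, Pos.head]

/-- The two words have isomorphic word posets, through an isomorphism that identifies the roots
attached to the positions. -/
def Compatible (cs : CoxeterSystem M W) (ω ω' : List B) : Prop :=
  ∃ f : Pos cs ω ≃o Pos cs ω', (∀ u, ω'.get (f u).idx = ω.get u.idx) ∧
    ∀ u, phiWord cs ω' (f u).idx = phiWord cs ω u.idx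

theorem Compatible.refl (ω : List B) : Compatible cs ω ω :=
  ⟨OrderIso.refl _, fun _ => rfl, fun _ => rfl⟩

theorem Compatible.symm {ω ω' : List B} (h : Compatible cs ω ω') : Compatible cs ω' ω := by
  obtain ⟨f, hl, hf⟩ := h
  refine ⟨f.symm, fun u => ?_, fun u => ?_⟩
  · rw [← hl, f.apply_symm_apply]
  · rw [← hf, f.apply_symm_apply]

theorem Compatible.trans {ω ω' ω'' : List B} (h : Compatible cs ω ω')
    (h' : Compatible cs ω' ω'') : Compatible cs ω ω'' := by
  obtain ⟨f, hl, hf⟩ := h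
  obtain ⟨g, hl', hg⟩ := h'
  exact ⟨f.trans g, fun u => (hl' (f u)).trans (hl u), fun u => (hg (f u)).trans (hf u)⟩

/-- Exchanging two adjacent letters `a ≠ b` that commute transposes two incomparable positions of
the word poset. -/
theorem compatible_of_commStep {ω ω' : List B} (h : CommStep cs ω ω') :
    Compatible cs ω ω' := by
  obtain ⟨l, r, a, b, hab, rfl, rfl⟩ := h
  by_cases hne : a = b
  · subst hne
    exact Compatible.refl _
  have hlen : ∀ x y : B, (l ++ x :: y :: r).length = l.length + r.length + 2 := fun x y => by
    simp only [List.length_append, List.length_cons]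
    omega
  -- the transposition, and its effect on labels, order and roots, for either order of the letters
  let t : ℕ → ℕ := fun i => Equiv.swap l.length (l.length + 1) i
  have ht : ∀ i, t i = if i = l.length then l.length + 1 else
      if i = l.length + 1 then l.length else i := fun i => Equiv.swap_apply_def _ _ _
  have htt : ∀ i, t (t i) = i := fun i => by simp [t]
  have htlt : ∀ i, i < l.length + r.length + 2 → t i < l.length + r.length + 2 := by
    intro i hi
    rw [ht]
    split_ifs <;> omega
  let g : ∀ x y : B, Fin (l ++ x :: y :: r).length → Fin (l ++ y :: x :: r).length :=
    fun x y i => ⟨t i, (htlt _ (i.2.trans_eq (hlen x y))).trans_eq (hlen y x).symm⟩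
  have hlab : ∀ x y i, (l ++ y :: x :: r).get (g x y i) = (l ++ x :: y :: r).get i := by
    rintro x y ⟨i, hi⟩
    simp only [g, List.get_eq_getElem, ht]
    rcases lt_trichotomy i l.length with h | h | h
    · rw [List.getElem_append_left h, List.getElem_append_left]
      · congr 1
        split_ifs <;> omega
      · split_ifs <;> omega
    · subst h
      simp [List.getElem_append_right]
    · obtain ⟨j, rfl⟩ : ∃ j, i = l.length + 1 + j := ⟨i - (l.length + 1), by omega⟩
      rcases j with _ | j
      · simp [List.getElem_append_right]
      · have e : l.length + 1 + (j + 1) = l.length + (j + 2) := by omega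
        simp only [e]
        simp [List.getElem_append_right]
  have harrow : ∀ x y, ¬ Dep cs x y → ∀ i j, Arrow cs (l ++ x :: y :: r) i j →
      Arrow cs (l ++ y :: x :: r) (g x y i) (g x y j) := by
    rintro x y hxy ⟨i, hi⟩ ⟨j, hj⟩ ⟨hij, hdep⟩
    refine ⟨?_, by rw [hlab, hlab]; exact hdep⟩
    simp only [Fin.mk_le_mk] at hij
    simp only [g, Fin.mk_le_mk, ht]
    by_cases hc : i = l.length ∧ j = l.length + 1
    · obtain ⟨rfl, rfl⟩ := hc
      simp [List.getElem_append_right] at hdep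
      exact absurd hdep hxy
    · split_ifs <;> omega
  have hnd : ¬ Dep cs a b := fun h => h.elim hne fun h => h hab
  have hnd' : ¬ Dep cs b a := fun h => hnd (dep_symm cs h)
  have hgg : ∀ x y i, g y x (g x y i) = i := fun x y i => Fin.ext (htt i.val)
  refine ⟨{ toFun := fun u => ⟨g a b u.idx⟩
            invFun := fun u => ⟨g b a u.idx⟩
            left_inv := fun u => Pos.idx_injective (hgg a b u.idx)
            right_inv := fun u => Pos.idx_injective (hgg b a u.idx)
            map_rel_iff' := ?_ }, fun u => hlab a b u.idx, ?_⟩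
  · intro u v
    constructor
    · intro h
      have := Relation.TransGen.lift (g b a) (harrow b a hnd') _ _ h
      change Relation.TransGen _ (g b a (g a b u.idx)) (g b a (g a b v.idx)) at this
      rwa [hgg, hgg] at this
    · intro h
      exact Relation.TransGen.lift (g a b) (harrow a b hnd) _ _ h
  · rintro ⟨i, hi⟩
    have h1 := hlab a b ⟨i, hi⟩
    change action cs (cs.wordProd ((l ++ b :: a :: r).take (t i)))
        (simpleRoot ((l ++ b :: a :: r).get (g a b ⟨i, hi⟩))) =
      action cs (cs.wordProd ((l ++ a :: b :: r).take i))
        (simpleRoot ((l ++ a :: b :: r).get ⟨i, hi⟩))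
    rw [h1]
    have hba : simpleAction M b (simpleRoot a) = simpleRoot a :=
      simpleAction_simpleRoot_of_not_dep cs hnd'
    have hab' : simpleAction M a (simpleRoot b) = simpleRoot b :=
      simpleAction_simpleRoot_of_not_dep cs hnd
    rcases lt_trichotomy i l.length with h | h | h
    · have e : t i = i := by rw [ht]; split_ifs <;> omega
      rw [e, List.take_append_of_le_length h.le, List.take_append_of_le_length h.le]
    · subst h
      have e : t l.length = l.length + 1 := by simp [t]
      simp only [e, List.get_eq_getElem]
      simp [List.take_append, List.take_of_length_le, cs.wordProd_append, action_simple, hba]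
    · obtain ⟨j, rfl⟩ : ∃ j, i = l.length + 1 + j := ⟨i - (l.length + 1), by omega⟩
      rcases j with _ | j
      · have e : t (l.length + 1 + 0) = l.length := by simp [t]
        simp only [e, List.get_eq_getElem]
        simp [List.take_append, List.take_of_length_le, List.getElem_append_right, cs.wordProd_append,
          action_simple, hab']
      · have e : t (l.length + 1 + (j + 1)) = l.length + (j + 2) := by
          rw [ht]
          split_ifs <;> omega
        have e' : l.length + 1 + (j + 1) = l.length + (j + 2) := by omega
        rw [e]
        congr 2
        rw [e', List.take_length_add_append, List.take_length_add_append]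
        simp only [List.take_succ_cons, cs.wordProd_append, cs.wordProd_cons]
        rw [← mul_assoc (cs.simple a), hab.eq, mul_assoc]

theorem compatible_of_eqvGen {ω ω' : List B} (h : Relation.EqvGen (CommStep cs) ω ω') :
    Compatible cs ω ω' := by
  induction h with
  | rel _ _ h => exact compatible_of_commStep h
  | refl _ => exact Compatible.refl _
  | symm _ _ _ ih => exact ih.symm
  | trans _ _ _ _ _ ih ih' => exact ih.trans ih'

/-- An order isomorphism of the posets of two words that preserves the labels, or that preserves
the roots attached to the positions, comes from commutations. The position `i` of `ω` that
corresponds to the first letter of `ω'` is minimal, so that its letter can be moved to the front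
of `ω`; each of the two assumptions shows that it is the first letter of `ω'`. -/
theorem eqvGen_of_orderIso {ω ω' : List B} (f : Pos cs ω ≃o Pos cs ω')
    (hf : (∀ u, ω'.get (f u).idx = ω.get u.idx) ∨
      (∀ u, phiWord cs ω' (f u).idx = phiWord cs ω u.idx)) :
    Relation.EqvGen (CommStep cs) ω ω' := by
  induction ω' generalizing ω with
  | nil =>
    cases ω with
    | nil => exact .refl _
    | cons b σ => exact (f (Pos.head b σ)).idx.elim0
  | cons a τ ih =>
    set u := f.symm (Pos.head a τ) with hu
    have hfu : f u = Pos.head a τ := f.apply_symm_apply _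
    have hmin : ∀ v, v ≤ u → v = u := fun v hv => by
      have := Pos.eq_head_of_le_head (hfu ▸ f.monotone hv)
      exact f.injective (this.trans hfu.symm)
    have hi := u.idx.2
    set i := u.idx.val with hidef
    set b := ω.get u.idx with hb
    have hω : ω = ω.take i ++ b :: ω.drop (i + 1) := by
      conv_lhs => rw [← List.take_append_drop i ω, List.drop_eq_getElem_cons hi]
      rfl
    have hmove := eqvGen_commStep_move_to_front (cs := cs) (ω.take i) (ω.drop (i + 1)) b (by
      intro c hc hdep
      obtain ⟨m, hm, rfl⟩ := List.mem_iff_getElem.1 hc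
      rw [List.length_take] at hm
      have hle : (⟨⟨m, by omega⟩⟩ : Pos cs ω) ≤ u :=
        Pos.le_of_arrow ⟨Fin.le_def.2 (by simp only; omega), by simpa [hb] using hdep⟩
      have := congrArg (fun x => x.idx.val) (hmin _ hle)
      simp only at this
      omega)
    rw [← hω] at hmove
    refine .trans _ _ _ hmove ?_
    set σ := ω.take i ++ ω.drop (i + 1) with hσ
    obtain ⟨g, hgl, hg⟩ := compatible_of_eqvGen hmove
    -- equally labelled minimal positions coincide
    have hgu : g u = Pos.head b σ := by
      have hle : (Pos.head b σ : Pos cs (b :: σ)) ≤ g u :=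
        Pos.le_of_arrow ⟨Nat.zero_le _, Or.inl (hgl u).symm⟩
      have h1 : g.symm (Pos.head b σ) ≤ u := by
        rwa [← g.le_iff_le, OrderIso.apply_symm_apply]
      rw [← hmin _ h1, OrderIso.apply_symm_apply]
    let h : Pos cs (b :: σ) ≃o Pos cs (a :: τ) := g.symm.trans f
    have hh : ∀ x, h x = f (g.symm x) := fun x => rfl
    have hh0 : h (Pos.head b σ) = Pos.head a τ := by
      rw [hh, ← hgu, OrderIso.symm_apply_apply, hfu]
    have hhf : (∀ x, (a :: τ).get (h x).idx = (b :: σ).get x.idx) ∨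
        (∀ x, phiWord cs (a :: τ) (h x).idx = phiWord cs (b :: σ) x.idx) := by
      refine hf.imp (fun hf x => ?_) (fun hf x => ?_)
      · rw [hh, hf, ← hgl, OrderIso.apply_symm_apply]
      · rw [hh, hf, ← hg, OrderIso.apply_symm_apply]
    have hba : b = a := by
      rcases hhf with hl | hp
      · have := hl (Pos.head b σ)
        rw [hh0] at this
        exact this.symm
      · have := hp (Pos.head b σ)
        rw [hh0, phiWord_head, phiWord_head] at this
        exact (simpleRoot_injective this).symm
    clear_value b
    subst hba
    obtain ⟨k, hk⟩ := exists_orderIso_of_cons h hh0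
    refine eqvGen_commStep_cons b (ih k ?_)
    refine hhf.imp (fun hl x => ?_) (fun hp x => ?_)
    · have := hl (Pos.cons b x)
      rw [hk] at this
      exact this
    · have := hp (Pos.cons b x)
      rw [hk, phiWord_cons, phiWord_cons] at this
      exact (action cs (cs.simple b)).injective this

theorem nonempty_iso_iff_eqvGen {ω ω' : List B} :
    Nonempty ((ofWord cs ω).Iso (ofWord cs ω')) ↔ Relation.EqvGen (CommStep cs) ω ω' := by
  refine ⟨fun ⟨f⟩ => eqvGen_of_orderIso f.1 (Or.inl f.2), fun h => ?_⟩
  obtain ⟨g, hl, -⟩ := compatible_of_eqvGen h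
  exact ⟨⟨g, hl⟩⟩

/-- By uniqueness of isomorphisms, each of them is compatible with the roots. -/
theorem phiWord_iso {ω ω' : List B} (f : (ofWord cs ω).Iso (ofWord cs ω')) (u : Pos cs ω) :
    phiWord cs ω' (f.1 u).idx = phiWord cs ω u.idx := by
  obtain ⟨g, hl, hg⟩ := compatible_of_eqvGen (nonempty_iso_iff_eqvGen.1 ⟨f⟩)
  rw [f.apply_eq ⟨g, hl⟩ u]
  exact hg u

end Compatible

/-! ### Depth in finite posets -/

section Depth

variable {P : Type*} [PartialOrder P]

theorem height_lt_top_of_finite [Finite P] (u : P) : Order.height u < ⊤ := by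
  refine lt_top_iff_ne_top.2 fun h => ?_
  have := Fintype.ofFinite P
  obtain ⟨p, -, hp⟩ := Order.height_eq_top_iff.1 h (Fintype.card P)
  exact absurd p.length_lt_card (by omega)

theorem dp_lt_dp [Finite P] {u v : P} (h : u < v) : dp u < dp v := by
  have h1 := Order.height_strictMono h (height_lt_top_of_finite u)
  obtain ⟨m, hm⟩ := ENat.ne_top_iff_exists.1 (height_lt_top_of_finite u).ne
  obtain ⟨n, hn⟩ := ENat.ne_top_iff_exists.1 (height_lt_top_of_finite v).ne
  rw [← hm, ← hn, Nat.cast_lt] at h1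
  rw [← PNat.coe_lt_coe]
  simpa [dp, ← hm, ← hn] using h1

theorem dp_eq_one {v : P} (h : ∀ u, ¬ u < v) : dp v = 1 := by
  have : Order.height v = 0 := Order.height_eq_zero.2 fun u hu =>
    not_lt_iff_le_imp_ge.1 (h u) hu
  simp [dp, this]
  rfl

theorem exists_covBy_dp_eq [Finite P] {v : P} (h : ∃ u, u < v) :
    ∃ u, u ⋖ v ∧ dp v = dp u + 1 := by
  obtain ⟨u₀, hu₀⟩ := h
  have hv := height_lt_top_of_finite v
  obtain ⟨n, hn⟩ := ENat.ne_top_iff_exists.1 hv.ne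
  have hn0 : n ≠ 0 := by
    rintro rfl
    have := Order.height_strictMono hu₀ (height_lt_top_of_finite u₀)
    rw [← hn] at this
    exact not_lt_zero this
  obtain ⟨m, rfl⟩ := Nat.exists_eq_succ_of_ne_zero hn0
  have hm : Order.height v = m + 1 := by
    rw [← hn]
    push_cast
    rfl
  obtain ⟨-, ⟨u, huv, hu⟩, hle⟩ := Order.height_eq_coe_add_one_iff.1 hm
  refine ⟨u, ⟨huv, fun x hux hxv => ?_⟩, ?_⟩
  · have h1 := Order.height_strictMono hux (height_lt_top_of_finite u)
    rw [hu] at h1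
    exact absurd (hle x hxv) (not_le.2 h1)
  · apply PNat.coe_injective
    simp [dp, hu, ← hn]

theorem dp_orderIso {Q : Type*} [PartialOrder Q] (f : P ≃o Q) (u : P) : dp (f u) = dp u := by
  rw [dp, dp, Order.height_orderIso]

end Depth

/-! ### The form on the roots of a reduced word -/

section FormOfRoots

variable {B : Type*} [Fintype B] [DecidableEq B] {W : Type*} [Group W] {M : CoxeterMatrix B}
variable {cs : CoxeterSystem M W}

theorem action_wordProd_take_succ_inv (ω : List B) {k : ℕ} (hk : k < ω.length) (x : B → ℝ) :
    action cs (cs.wordProd (ω.take (k + 1)))⁻¹ x =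
      simpleAction M (ω.get ⟨k, hk⟩) (action cs (cs.wordProd (ω.take k))⁻¹ x) := by
  rw [← List.take_append_getElem hk, cs.wordProd_append, cs.wordProd_singleton, mul_inv_rev,
    cs.inv_simple, action_mul_apply, action_simple]
  rfl

theorem action_take_inv_phiWord (ω : List B) (i : Fin ω.length) :
    action cs (cs.wordProd (ω.take (i + 1)))⁻¹ (phiWord cs ω i) = -simpleRoot (ω.get i) := by
  rw [action_wordProd_take_succ_inv ω i.2, phiWord, action_inv_apply_self,
    simpleAction_simpleRoot_self]

theorem form_phiWord (ω : List B) (x : B → ℝ) (j : Fin ω.length) :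
    form M x (phiWord cs ω j) =
      ∑ c, gram M (ω.get j) c * action cs (cs.wordProd (ω.take j))⁻¹ x c := by
  rw [← form_simpleRoot_left, form_comm, phiWord,
    ← form_action cs (cs.wordProd (ω.take j)) (simpleRoot _), action_apply_inv_self]

/-- The root attached to a position `u`, pulled back along a longer prefix of the word, is supported
on the labels of the positions of that prefix above `u` in the word poset. -/
theorem exists_le_of_action_take_inv_ne_zero {ω : List B} (u : Pos cs ω) {k : ℕ}
    (huk : u.idx.val + 1 ≤ k) (hk : k ≤ ω.length) {c : B}
    (hc : action cs (cs.wordProd (ω.take k))⁻¹ (phiWord cs ω u.idx) c ≠ 0) :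
    ∃ m : Pos cs ω, m.idx.val < k ∧ u ≤ m ∧ ω.get m.idx = c := by
  induction k, huk using Nat.le_induction generalizing c with
  | base =>
    rw [action_take_inv_phiWord] at hc
    refine ⟨u, by omega, le_rfl, ?_⟩
    by_contra hne
    exact hc (by rw [Pi.neg_apply, simpleRoot, Pi.single_eq_of_ne (Ne.symm hne), neg_zero])
  | succ k huk ih =>
    have hk' : k < ω.length := hk
    rw [action_wordProd_take_succ_inv ω hk'] at hc
    set x := action cs (cs.wordProd (ω.take k))⁻¹ (phiWord cs ω u.idx) with hx
    by_cases hxc : x c = 0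
    · have hck : c = ω.get ⟨k, hk'⟩ := by
        by_contra hne
        exact hc (by rw [simpleAction_apply_of_ne M hne, hxc])
      have hform : form M (simpleRoot c) x ≠ 0 := fun h0 => hc (by
        rw [← hck, simpleAction_apply, h0]
        simpa using hxc)
      rw [form_simpleRoot_left] at hform
      obtain ⟨d, -, hd⟩ := Finset.exists_ne_zero_of_sum_ne_zero hform
      obtain ⟨m, hmk, hum, rfl⟩ := ih hk'.le (right_ne_zero_of_mul hd)
      refine ⟨⟨⟨k, hk'⟩⟩, by simp, hum.trans (Pos.le_of_arrow ⟨Fin.le_def.2 hmk.le, ?_⟩), hck.symm⟩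
      rw [← hck]
      exact dep_symm cs (dep_of_gram_ne_zero cs (left_ne_zero_of_mul hd))
    · obtain ⟨m, hmk, hum, hmc⟩ := ih hk'.le hxc
      exact ⟨m, by omega, hum, hmc⟩

theorem le_of_form_phiWord_ne_zero {ω : List B} {u v : Pos cs ω} (huv : u.idx < v.idx)
    (h : form M (phiWord cs ω u.idx) (phiWord cs ω v.idx) ≠ 0) : u ≤ v := by
  rw [form_phiWord] at h
  obtain ⟨c, -, hc⟩ := Finset.exists_ne_zero_of_sum_ne_zero h
  obtain ⟨m, hmv, hum, rfl⟩ := exists_le_of_action_take_inv_ne_zero u (Fin.lt_def.1 huv)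
    v.idx.2.le (right_ne_zero_of_mul hc)
  exact hum.trans (Pos.le_of_arrow
    ⟨Fin.le_def.2 hmv.le, dep_symm cs (dep_of_gram_ne_zero cs (left_ne_zero_of_mul hc))⟩)

/-- Positions whose roots are not orthogonal are comparable. -/
theorem comparable_of_form_phiWord_ne_zero {ω : List B} {u v : Pos cs ω}
    (h : form M (phiWord cs ω u.idx) (phiWord cs ω v.idx) ≠ 0) : u ≤ v ∨ v ≤ u := by
  rcases lt_trichotomy u.idx v.idx with h1 | h1 | h1
  · exact Or.inl (le_of_form_phiWord_ne_zero h1 h)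
  · exact Or.inl (Pos.idx_injective h1).le
  · exact Or.inr (le_of_form_phiWord_ne_zero h1 (by rwa [form_comm]))

theorem phiWord_mem_R {ω : List B} (hω : cs.IsReduced ω) (i : Fin ω.length) :
    phiWord cs ω i ∈ R cs (cs.wordProd ω) :=
  (bijOn_phiWord cs hω).mapsTo trivial

/-- If `v` covers `u` in the word poset of a reduced word, then the roots attached to `u` and `v`
have a positive product. The positions above `u` and before `v` other than `u` are labelled by
letters that commute with the label `b` of `v`; so only the label `a` of `u` contributes to the
product, which equals `-(r_a, r_b)`. The case `a = b` would make the two roots opposite. -/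
theorem form_phiWord_pos_of_covBy {ω : List B} (hω : cs.IsReduced ω) {u v : Pos cs ω}
    (huv : u ⋖ v) : 0 < form M (phiWord cs ω u.idx) (phiWord cs ω v.idx) := by
  have hdep : Dep cs (ω.get u.idx) (ω.get v.idx) := dep_of_pos_covBy cs ω u v huv
  have hlt : u.idx.val < v.idx.val := lt_of_le_of_ne (Pos.idx_le huv.le)
    fun h => huv.ne (Pos.idx_val_injective h)
  have hbetween : ∀ m : Pos cs ω, u ≤ m → m.idx.val < v.idx.val → m ≠ u →
      ¬ Dep cs (ω.get m.idx) (ω.get v.idx) := fun m hum hmv hne hd =>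
    huv.2 (lt_of_le_of_ne hum hne.symm)
      (lt_of_le_of_ne (Pos.le_of_arrow ⟨Fin.le_def.2 hmv.le, hd⟩)
        fun h => hmv.ne (congrArg (fun x => x.idx.val) h))
  by_cases hab : ω.get u.idx = ω.get v.idx
  · exfalso
    have key : ∀ k, u.idx.val + 1 ≤ k → k ≤ v.idx.val →
        action cs (cs.wordProd (ω.take k))⁻¹ (phiWord cs ω u.idx) =
          -simpleRoot (ω.get u.idx) := by
      intro k hk
      induction k, hk using Nat.le_induction with
      | base => exact fun _ => action_take_inv_phiWord ω u.idx
      | succ k hk ih =>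
        intro hkv
        have hkω : k < ω.length := by omega
        have hd : ¬ Dep cs (ω.get ⟨k, hkω⟩) (ω.get u.idx) := fun hd =>
          hbetween ⟨⟨k, hkω⟩⟩
            (Pos.le_of_arrow ⟨Fin.le_def.2 (by simp only; omega), dep_symm cs hd⟩) hkv
            (fun h => by
              have := congrArg (fun x => x.idx.val) h
              simp only at this
              omega) (hab ▸ hd)
        rw [action_wordProd_take_succ_inv ω hkω, ih (by omega), map_neg,
          simpleAction_simpleRoot_of_not_dep cs hd]
    have h1 := congrArg (action cs (cs.wordProd (ω.take v.idx))) (key _ hlt le_rfl)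
    rw [action_apply_inv_self, map_neg, hab] at h1
    have hv : phiWord cs ω v.idx ∈ posRoots cs := (phiWord_mem_R hω v.idx).1
    exact not_mem_posRoots_of_mem_negRoots (neg_mem_negRoots hv)
      (h1 ▸ (phiWord_mem_R hω u.idx).1)
  · have hcoeff : ∀ k, u.idx.val + 1 ≤ k → k ≤ v.idx.val →
        action cs (cs.wordProd (ω.take k))⁻¹ (phiWord cs ω u.idx) (ω.get u.idx) = -1 := by
      intro k hk
      induction k, hk using Nat.le_induction with
      | base =>
        intro _
        rw [action_take_inv_phiWord]
        simp [simpleRoot]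
      | succ k hk ih =>
        intro hkv
        have hkω : k < ω.length := by omega
        have hne : ω.get u.idx ≠ ω.get ⟨k, hkω⟩ := fun he =>
          hbetween ⟨⟨k, hkω⟩⟩
            (Pos.le_of_arrow ⟨Fin.le_def.2 (by simp only; omega), Or.inl he⟩) hkv
            (fun h => by
              have := congrArg (fun x => x.idx.val) h
              simp only at this
              omega) (he ▸ hdep)
        rw [action_wordProd_take_succ_inv ω hkω, simpleAction_apply_of_ne M hne, ih (by omega)]
    rw [form_phiWord, Finset.sum_eq_single (ω.get u.idx), hcoeff _ hlt le_rfl, gram_comm]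
    · have := gram_neg_of_dep cs hab hdep
      linarith
    · intro c _ hca
      by_contra hne
      obtain ⟨m, hmv, hum, rfl⟩ := exists_le_of_action_take_inv_ne_zero u hlt
        v.idx.2.le (right_ne_zero_of_mul hne)
      exact hbetween m hum hmv (fun h => hca (by rw [h]))
        (dep_symm cs (dep_of_gram_ne_zero cs (left_ne_zero_of_mul hne)))
    · simp

end FormOfRoots

/-! ### Depth functions of reduced words -/

section DepthOfWords

variable {B : Type*} [Fintype B] [DecidableEq B] {W : Type*} [Group W] {M : CoxeterMatrix B}
variable {cs : CoxeterSystem M W}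

/-- `lam` is the depth function of the word `ω`: at the root attached to a position it is the depth
of the position in the word poset. (Meant for a reduced word of `w`.) -/
def IsDepth (cs : CoxeterSystem M W) (ω : List B) {w : W} (lam : R cs w → ℕ+) : Prop :=
  ∀ (u : Pos cs ω) (h : phiWord cs ω u.idx ∈ R cs w), lam ⟨phiWord cs ω u.idx, h⟩ = dp u

theorem phiWord_mem_R_of_mem_reducedWords {ω : List B} {w : W} (hω : ω ∈ reducedWords cs w)
    (i : Fin ω.length) : phiWord cs ω i ∈ R cs w :=
  hω.2 ▸ phiWord_mem_R hω.1 i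

theorem exists_phiWord_eq {ω : List B} {w : W} (hω : ω ∈ reducedWords cs w) {r : B → ℝ}
    (hr : r ∈ R cs w) : ∃ u : Pos cs ω, phiWord cs ω u.idx = r := by
  obtain ⟨hred, rfl⟩ := hω
  obtain ⟨i, -, hi⟩ := (bijOn_phiWord cs hred).surjOn hr
  exact ⟨⟨i⟩, hi⟩

theorem eq_of_phiWord_eq {ω : List B} {w : W} (hω : ω ∈ reducedWords cs w) {u v : Pos cs ω}
    (h : phiWord cs ω u.idx = phiWord cs ω v.idx) : u = v :=
  Pos.idx_injective ((bijOn_phiWord cs hω.1).injOn trivial trivial h)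

theorem IsDepth.unique {ω : List B} {w : W} (hω : ω ∈ reducedWords cs w) {lam lam' : R cs w → ℕ+}
    (h : IsDepth cs ω lam) (h' : IsDepth cs ω lam') : lam = lam' := by
  ext1 ⟨r, hr⟩
  obtain ⟨u, rfl⟩ := exists_phiWord_eq hω hr
  rw [h, h']

theorem exists_isDepth {ω : List B} {w : W} (hω : ω ∈ reducedWords cs w) :
    ∃ lam : R cs w → ℕ+, IsDepth cs ω lam := by
  choose u hu using fun r : R cs w => exists_phiWord_eq hω r.2
  refine ⟨fun r => dp (u r), fun v hv => ?_⟩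
  exact congrArg dp (eq_of_phiWord_eq hω (hu ⟨_, hv⟩))

theorem IsDepth.of_eqvGen {ω ω' : List B} {w : W} {lam : R cs w → ℕ+} (h : IsDepth cs ω lam)
    (hωω' : Relation.EqvGen (CommStep cs) ω ω') : IsDepth cs ω' lam := by
  obtain ⟨f, -, hf⟩ := compatible_of_eqvGen (hωω'.symm)
  intro u hu
  rw [← dp_orderIso f, ← h (f u) (by rwa [hf])]
  congr 1
  exact Subtype.ext (hf u).symm

/-- The depth function of a reduced word determines the order of the word poset, as an order on
roots: it is generated by the pairs of roots with a positive product, taken in the direction of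
increasing depth. -/
theorem eqvGen_of_isDepth {ω ω' : List B} {w : W} (hω : ω ∈ reducedWords cs w)
    (hω' : ω' ∈ reducedWords cs w) {lam : R cs w → ℕ+} (h : IsDepth cs ω lam)
    (h' : IsDepth cs ω' lam) : Relation.EqvGen (CommStep cs) ω ω' := by
  have key : ∀ {ω ω' : List B}, ω ∈ reducedWords cs w → IsDepth cs ω lam → IsDepth cs ω' lam →
      ∀ e : Pos cs ω → Pos cs ω', (∀ u, phiWord cs ω' (e u).idx = phiWord cs ω u.idx) →
      Monotone e := by
    intro ω ω' hω h h' e he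
    classical
    let _ := Fintype.ofFinite (Pos cs ω)
    let _ : LocallyFiniteOrder (Pos cs ω) := LocallyFiniteOrder.ofFiniteIcc fun _ _ => Set.toFinite _
    rw [monotone_iff_forall_covBy]
    intro a b hab
    have hform := form_phiWord_pos_of_covBy hω.1 hab
    rw [← he, ← he] at hform
    refine (comparable_of_form_phiWord_ne_zero hform.ne').resolve_right fun hle => ?_
    have hdp : ∀ u, dp (e u) = dp u := fun u => by
      have hu := phiWord_mem_R_of_mem_reducedWords hω u.idx
      rw [← h u hu, ← h' (e u) (by rwa [he])]
      congr 1
      exact Subtype.ext (he u)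
    have h1 := dp_lt_dp hab.lt
    rw [← hdp a, ← hdp b] at h1
    rcases hle.eq_or_lt with h2 | h2
    · rw [h2] at h1
      exact lt_irrefl _ h1
    · exact lt_asymm h1 (dp_lt_dp h2)
  choose e he using fun u : Pos cs ω =>
    exists_phiWord_eq hω' (phiWord_mem_R_of_mem_reducedWords hω u.idx)
  choose e' he' using fun u : Pos cs ω' =>
    exists_phiWord_eq hω (phiWord_mem_R_of_mem_reducedWords hω' u.idx)
  have h1 := key hω h h' e he
  have h2 := key hω' h' h e' he'
  have hl : ∀ u, e' (e u) = u := fun u => eq_of_phiWord_eq hω (by rw [he', he])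
  have hr : ∀ u, e (e' u) = u := fun u => eq_of_phiWord_eq hω' (by rw [he, he'])
  exact eqvGen_of_orderIso (Equiv.toOrderIso ⟨e, e', hl, hr⟩ h1 h2) (Or.inr he)

/-! ### The recursive description of the depth functions -/

/-- A position of `ω`, as a position of `ω ++ [s]`. -/
def Pos.init (s : B) {ω : List B} (u : Pos cs ω) : Pos cs (ω ++ [s]) :=
  ⟨⟨u.idx.val, by have := u.idx.2; simp only [List.length_append, List.length_singleton]; omega⟩⟩

/-- The last position of `ω ++ [s]`. -/
def Pos.last (ω : List B) (s : B) : Pos cs (ω ++ [s]) := ⟨⟨ω.length, by simp⟩⟩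

theorem Pos.init_le_init {s : B} {ω : List B} {u v : Pos cs ω} :
    Pos.init s u ≤ Pos.init s v ↔ u ≤ v :=
  transGen_arrow_factor (ω := ω) (ω' := ω ++ [s]) 0
    (fun i => (Pos.init (cs := cs) s ⟨i⟩).idx) (fun _ => rfl)
    (fun i => by simp [Pos.init, List.getElem_append_left]) _ _

theorem Pos.exists_init_eq {s : B} {ω : List B} {u : Pos cs (ω ++ [s])}
    (h : u.idx.val < ω.length) : ∃ v, Pos.init s v = u :=
  ⟨⟨⟨u.idx.val, h⟩⟩, rfl⟩

theorem Pos.exists_init_eq_of_lt {s : B} {ω : List B} {u v : Pos cs (ω ++ [s])} (h : u < v) :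
    ∃ x, Pos.init s x = u := by
  have h1 := Pos.idx_le h.le
  have h2 : u.idx.val ≠ v.idx.val := fun he => h.ne (Pos.idx_val_injective he)
  have h3 : v.idx.val < ω.length + 1 := by simpa using v.idx.2
  exact Pos.exists_init_eq (by have := Fin.le_def.1 h1; omega)

theorem Pos.eq_last {s : B} {ω : List B} {u : Pos cs (ω ++ [s])} (h : ¬ u.idx.val < ω.length) :
    u = Pos.last ω s := by
  have : u.idx.val < ω.length + 1 := by simpa using u.idx.2
  exact Pos.idx_val_injective (by simp only [Pos.last]; omega)

theorem Pos.init_lt_last_of_comparable {s : B} {ω : List B} {u : Pos cs ω}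
    (h : Pos.init s u ≤ Pos.last ω s ∨ Pos.last ω s ≤ Pos.init s u) :
    Pos.init s u < Pos.last ω s := by
  have hu : u.idx.val < ω.length := u.idx.2
  have hne : Pos.init s u ≠ Pos.last ω s := fun he =>
    hu.ne (congrArg (fun x => x.idx.val) he)
  refine lt_of_le_of_ne (h.resolve_right fun hle => ?_) hne
  exact absurd hu (not_lt.2 (Fin.le_def.1 (Pos.idx_le hle)))

theorem phiWord_init (ω : List B) (s : B) (u : Pos cs ω) :
    phiWord cs (ω ++ [s]) (Pos.init s u).idx = phiWord cs ω u.idx :=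
  phiWord_append_singleton cs ω s _ u.idx.2

theorem dp_init (s : B) {ω : List B} (u : Pos cs ω) : dp (Pos.init s u) = dp u := by
  have hinj : ∀ x y : Pos cs ω, Pos.init s x = Pos.init s y → x = y := fun x y h =>
    le_antisymm (Pos.init_le_init.1 h.le) (Pos.init_le_init.1 h.ge)
  have hlt : ∀ x y : Pos cs ω, Pos.init s x < Pos.init s y ↔ x < y := fun x y => by
    rw [lt_iff_le_not_ge, lt_iff_le_not_ge, Pos.init_le_init, Pos.init_le_init]
  rw [dp, dp, ← Order.height_eq_of_strictMono (Pos.init s) (fun x y h => (hlt x y).2 h)]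
  intro a b hb
  obtain ⟨x, rfl⟩ := Pos.exists_init_eq_of_lt hb
  exact ⟨x, (hlt _ _).1 hb, rfl⟩

theorem append_singleton_mem_reducedWords {ω : List B} {s : B} (hω : cs.IsReduced ω)
    (hs : ¬ cs.IsRightDescent (cs.wordProd ω) s) :
    ω ++ [s] ∈ reducedWords cs (cs.wordProd ω * cs.simple s) :=
  ⟨(isReduced_append_singleton_iff cs ω s).2 ⟨hω, hs⟩, by
    rw [cs.wordProd_append, cs.wordProd_singleton]⟩

/-- Appending a letter to a reduced word changes the depth function as `Φ` prescribes: the depth of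
the new position is one more than that of some position it covers, the roots of the positions that
it covers have a positive product with the new root, and the positions whose roots have a positive
product with the new root are below the new position. -/
theorem isPhi_of_isDepth {ω : List B} {s : B} (hω : cs.IsReduced ω)
    (hs : ¬ cs.IsRightDescent (cs.wordProd ω) s) {lam : R cs (cs.wordProd ω) → ℕ+}
    {lam' : R cs (cs.wordProd ω * cs.simple s) → ℕ+} (h : IsDepth cs ω lam)
    (h' : IsDepth cs (ω ++ [s]) lam') : IsPhi cs (cs.wordProd ω) s lam lam' := by
  have hω' : ω ∈ reducedWords cs (cs.wordProd ω) := ⟨hω, rfl⟩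
  have hωs := append_singleton_mem_reducedWords hω hs
  rintro ⟨r, hr⟩
  obtain ⟨v, rfl⟩ := exists_phiWord_eq hωs hr
  refine ⟨fun hmem => ?_, fun hnot => ?_⟩
  · obtain ⟨u, hu⟩ := exists_phiWord_eq hω' hmem
    have hv : v = Pos.init s u := eq_of_phiWord_eq hωs (by rw [phiWord_init, hu])
    subst hv
    rw [h', dp_init, ← h u (phiWord_mem_R hω _)]
    congr 1
    exact Subtype.ext hu
  · have hv : v = Pos.last ω s := Pos.eq_last fun hlt => by
      obtain ⟨u, rfl⟩ := Pos.exists_init_eq hlt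
      exact hnot ((phiWord_init ω s u).symm ▸ phiWord_mem_R hω u.idx :
        phiWord cs (ω ++ [s]) (Pos.init s u).idx ∈ R cs (cs.wordProd ω))
    rw [h']
    simp only
    have hcov : ∀ u : Pos cs ω, Pos.init s u ⋖ v →
        0 < form M (phiWord cs (ω ++ [s]) v.idx) (phiWord cs ω u.idx) := fun u hu => by
      rw [form_comm, ← phiWord_init ω s u]
      exact form_phiWord_pos_of_covBy hωs.1 hu
    have hbelow : ∀ u : Pos cs ω,
        0 < form M (phiWord cs (ω ++ [s]) v.idx) (phiWord cs ω u.idx) → Pos.init s u < v := by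
      intro u hu
      rw [form_comm, ← phiWord_init ω s u] at hu
      subst hv
      exact Pos.init_lt_last_of_comparable (comparable_of_form_phiWord_ne_zero hu.ne')
    by_cases hex : Nonempty {u : Pos cs ω //
        0 < form M (phiWord cs (ω ++ [s]) v.idx) (phiWord cs ω u.idx)}
    · right
      obtain ⟨⟨u₀, hu₀⟩, hmax⟩ := Finite.exists_max (fun u : {u : Pos cs ω //
        0 < form M (phiWord cs (ω ++ [s]) v.idx) (phiWord cs ω u.idx)} => dp u.1)
      refine ⟨⟨_, phiWord_mem_R hω u₀.idx⟩, hu₀, ?_, ?_⟩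
      · rintro ⟨r, hr⟩ hpos
        obtain ⟨u, rfl⟩ := exists_phiWord_eq hω' hr
        rw [h, h]
        exact hmax ⟨u, hpos⟩
      · rw [h]
        have h1 := dp_lt_dp (hbelow u₀ hu₀)
        rw [dp_init] at h1
        obtain ⟨x, hx, hdx⟩ := exists_covBy_dp_eq ⟨_, hbelow u₀ hu₀⟩
        obtain ⟨u, rfl⟩ := Pos.exists_init_eq_of_lt hx.lt
        rw [dp_init] at hdx
        have h2 : dp u ≤ dp u₀ := hmax ⟨u, hcov u hx⟩
        rw [hdx] at h1 ⊢
        rw [le_antisymm h2 (PNat.lt_add_one_iff.1 h1)]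
    · left
      refine ⟨fun r' hpos => ?_, dp_eq_one fun x hx => ?_⟩
      · obtain ⟨u, hu⟩ := exists_phiWord_eq hω' r'.2
        exact hex ⟨⟨u, by rw [hu]; exact hpos⟩⟩
      · obtain ⟨y, hy, -⟩ := exists_covBy_dp_eq ⟨x, hx⟩
        obtain ⟨u, rfl⟩ := Pos.exists_init_eq_of_lt hy.lt
        exact hex ⟨⟨u, hcov u hy⟩⟩

theorem IsPhi.unique {w : W} {s : B} {lam : R cs w → ℕ+} {lam₁ lam₂ : R cs (w * cs.simple s) → ℕ+}
    (h₁ : IsPhi cs w s lam lam₁) (h₂ : IsPhi cs w s lam lam₂) : lam₁ = lam₂ := by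
  ext1 r
  by_cases hr : (r : B → ℝ) ∈ R cs w
  · rw [(h₁ r).1 hr, (h₂ r).1 hr]
  · rcases (h₁ r).2 hr with ⟨hn₁, e₁⟩ | ⟨r₁, hp₁, hm₁, e₁⟩ <;>
      rcases (h₂ r).2 hr with ⟨hn₂, e₂⟩ | ⟨r₂, hp₂, hm₂, e₂⟩
    · rw [e₁, e₂]
    · exact absurd hp₂ (hn₁ r₂)
    · exact absurd hp₁ (hn₂ r₁)
    · rw [e₁, e₂, le_antisymm (hm₂ r₁ hp₁) (hm₁ r₂ hp₂)]

/-- The elements of `C(w)` are the depth functions of the reduced words of `w`. -/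
theorem memC_iff_exists_isDepth {w : W} {lam : R cs w → ℕ+} :
    MemC cs w lam ↔ ∃ ω ∈ reducedWords cs w, IsDepth cs ω lam := by
  constructor
  · intro h
    induction h with
    | one lam =>
      refine ⟨[], ⟨?_, cs.wordProd_nil⟩, fun u => u.idx.elim0⟩
      simp [CoxeterSystem.IsReduced]
    | mul w s lam lam' hs _ hphi ih =>
      obtain ⟨ω, ⟨hω, rfl⟩, hd⟩ := ih
      have hωs := append_singleton_mem_reducedWords hω hs
      obtain ⟨lam'', h''⟩ := exists_isDepth hωs
      rw [hphi.unique (isPhi_of_isDepth hω hs hd h'')]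
      exact ⟨_, hωs, h''⟩
  · rintro ⟨ω, ⟨hω, hw⟩, hd⟩
    induction ω using List.reverseRecOn generalizing w lam with
    | nil =>
      rw [cs.wordProd_nil] at hw
      subst hw
      exact .one lam
    | append_singleton ω s ih =>
      rw [cs.wordProd_append, cs.wordProd_singleton] at hw
      subst hw
      obtain ⟨hω', hs⟩ := (isReduced_append_singleton_iff cs ω s).1 hω
      obtain ⟨lam₀, h₀⟩ := exists_isDepth (cs := cs) ⟨hω', rfl⟩
      exact .mul _ s lam₀ lam hs (ih h₀ hω' rfl) (isPhi_of_isDepth hω' hs h₀ hd)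

/-! ### Depth functions of word posets -/

theorem WordPoset.phi_eq_phiWord {P : WordPoset cs} {w : W} (hP : P.IsReducedFor w) {ω : List B}
    (f : P.Iso (ofWord cs ω)) (u : P.carrier) :
    WordPoset.phi hP u = phiWord cs ω (f.1 u).idx := by
  set f₀ := Classical.choice hP.choose_spec.2 with hf₀
  have h1 := phiWord_iso (f₀.symm.trans f) (f₀.1 u)
  have h2 : (f₀.symm.trans f).1 (f₀.1 u) = f.1 u := congrArg f.1 (f₀.1.symm_apply_apply u)
  rw [h2] at h1
  exact h1.symm

theorem WordPoset.isDepth_depthFun {P : WordPoset cs} {w : W} (hP : P.IsReducedFor w)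
    {ω : List B} (hω : ω ∈ reducedWords cs w) (f : P.Iso (ofWord cs ω)) :
    IsDepth cs ω (WordPoset.depthFun hP) := by
  intro u hu
  obtain ⟨x, rfl⟩ := f.1.surjective u
  have hex : ∃ y, WordPoset.phi hP y = phiWord cs ω (f.1 x).idx := ⟨x, phi_eq_phiWord hP f x⟩
  have h1 := hex.choose_spec
  rw [phi_eq_phiWord hP f] at h1
  have h2 : hex.choose = x := f.1.injective (eq_of_phiWord_eq hω h1)
  have h3 : WordPoset.depthFun hP ⟨phiWord cs ω (f.1 x).idx, hu⟩ = dp hex.choose := dif_pos hex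
  rw [h3, h2]
  exact (dp_orderIso f.1 x).symm

theorem WordPoset.bijOn_phi {P : WordPoset cs} {w : W} (hP : P.IsReducedFor w) :
    Set.BijOn (WordPoset.phi hP) Set.univ (R cs w) := by
  obtain ⟨ω, hω, ⟨f⟩⟩ := id hP
  have hphi := phi_eq_phiWord hP f
  refine ⟨fun u _ => ?_, fun u _ v _ huv => ?_, fun r hr => ?_⟩
  · rw [hphi]
    exact phiWord_mem_R_of_mem_reducedWords hω _
  · rw [hphi, hphi] at huv
    exact f.1.injective (eq_of_phiWord_eq hω huv)
  · obtain ⟨u, rfl⟩ := exists_phiWord_eq hω hr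
    obtain ⟨x, rfl⟩ := f.1.surjective u
    exact ⟨x, trivial, hphi x⟩

theorem WordPoset.words_eq_commClass {P : WordPoset cs} {ω : List B}
    (f : P.Iso (ofWord cs ω)) : P.words = commClass cs ω := by
  ext ω'
  change Nonempty (P.Iso (ofWord cs ω')) ↔ Relation.EqvGen (CommStep cs) ω ω'
  rw [← nonempty_iso_iff_eqvGen]
  exact ⟨fun ⟨g⟩ => ⟨f.symm.trans g⟩, fun ⟨g⟩ => ⟨f.trans g⟩⟩

theorem commClass_eq_iff {ω ω' : List B} :
    commClass cs ω = commClass cs ω' ↔ Relation.EqvGen (CommStep cs) ω ω' := by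
  constructor
  · intro h
    have : ω' ∈ commClass cs ω' := Relation.EqvGen.refl _
    rwa [← h] at this
  · intro h
    ext x
    exact ⟨fun hx => .trans _ _ _ (.symm _ _ h) hx, fun hx => .trans _ _ _ h hx⟩

/-- The commutation classes of reduced words of `w` correspond to the elements of `C(w)`, a class
to the common depth function of its words. -/
theorem exists_equiv_commClasses_C (cs : CoxeterSystem M W) (w : W) :
    ∃ F : commClasses cs w ≃ C cs w, ∀ (c : commClasses cs w) (ω : List B),
      (c : Set (List B)) = commClass cs ω →
      IsDepth cs ω (F c : R cs w → ℕ+) := by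
  have h1 : ∀ c : commClasses cs w, ∃ lam : C cs w, ∀ ω : List B,
      (c : Set (List B)) = commClass cs ω → IsDepth cs ω (lam : R cs w → ℕ+) := by
    rintro ⟨_, ω, hω, rfl⟩
    obtain ⟨lam, hlam⟩ := exists_isDepth hω
    exact ⟨⟨lam, memC_iff_exists_isDepth.2 ⟨ω, hω, hlam⟩⟩, fun ω' h =>
      hlam.of_eqvGen (commClass_eq_iff.1 h)⟩
  choose F hF using h1
  refine ⟨Equiv.ofBijective F ⟨?_, ?_⟩, hF⟩
  · rintro ⟨_, ω, hω, rfl⟩ ⟨_, ω', hω', rfl⟩ h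
    have h2 := hF ⟨_, ω, hω, rfl⟩ ω rfl
    rw [h] at h2
    exact Subtype.ext (commClass_eq_iff.2 (eqvGen_of_isDepth hω hω' h2 (hF _ ω' rfl)))
  · rintro ⟨lam, hlam⟩
    obtain ⟨ω, hω, hd⟩ := memC_iff_exists_isDepth.1 hlam
    exact ⟨⟨_, ω, hω, rfl⟩, Subtype.ext ((hF _ ω rfl).unique hω hd)⟩

end DepthOfWords

end CoxWord

open CoxWord in
theorem corollary1 {B : Type*} [Fintype B] [DecidableEq B] {W : Type*} [Group W]
    {M : CoxeterMatrix B} (cs : CoxeterSystem M W) (w : W) :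
    (∀ (P : WordPoset cs) (hP : P.IsReducedFor w),
      (∀ ω ∈ P.words, ∀ (f : P.Iso (ofWord cs ω)) (u : P.carrier),
        WordPoset.phi hP u = phiWord cs ω (f.1 u).idx) ∧
      Set.BijOn (WordPoset.phi hP) Set.univ (R cs w)) ∧
    (∃ F : commClasses cs w ≃ C cs w,
      ∀ (P : WordPoset cs) (hP : P.IsReducedFor w), ∃ h : P.words ∈ commClasses cs w,
        (F ⟨P.words, h⟩ : R cs w → ℕ+) = WordPoset.depthFun hP) ∧
    (∀ (P P' : WordPoset cs) (hP : P.IsReducedFor w) (hP' : P'.IsReducedFor w),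
      WordPoset.depthFun hP = WordPoset.depthFun hP' ↔ Nonempty (P.Iso P')) := by
  refine ⟨fun P hP => ⟨fun ω _ f u => WordPoset.phi_eq_phiWord hP f u, WordPoset.bijOn_phi hP⟩,
    ?_, fun P P' hP hP' => ⟨fun h => ?_, ?_⟩⟩
  · obtain ⟨F, hF⟩ := exists_equiv_commClasses_C cs w
    refine ⟨F, fun P hP => ?_⟩
    obtain ⟨ω, hω, ⟨f⟩⟩ := id hP
    have hwords := WordPoset.words_eq_commClass f
    exact ⟨⟨ω, hω, hwords⟩, (hF _ ω hwords).unique hω (WordPoset.isDepth_depthFun hP hω f)⟩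
  · obtain ⟨ω, hω, ⟨f⟩⟩ := id hP
    obtain ⟨ω', hω', ⟨f'⟩⟩ := id hP'
    have hd := WordPoset.isDepth_depthFun hP hω f
    rw [h] at hd
    obtain ⟨g⟩ := nonempty_iso_iff_eqvGen.2
      (eqvGen_of_isDepth hω hω' hd (WordPoset.isDepth_depthFun hP' hω' f'))
    exact ⟨(f.trans g).trans f'.symm⟩
  · rintro ⟨g⟩
    obtain ⟨ω, hω, ⟨f⟩⟩ := id hP
    exact (WordPoset.isDepth_depthFun hP hω f).unique hω
      (WordPoset.isDepth_depthFun hP' hω (g.symm.trans f))
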